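/- Let $\Gamma=(V,E)$ be a finite, connected, simple graph with at least one edge, $N=\#E$. Identify each edge $e$ with the interval $[0,1]$, i.e. choose an arbitrary orientation of each edge, and for $v\in V$, $e\in E$ put $d_{ve}=1$ if $v$ is the end of $e$ at the parameter $1$, $d_{ve}=-1$ if $v$ is the end of $e$ at the parameter $0$, and $d_{ve}=0$ otherwise. For $u=(u_e)_{e\in E}\in C^2([0,1];\mathbb C)^N$ and $v\in e$, write $u_e(v)$ and $u_e'(v)$ for the values of $u_e$ and $u_e'$ at the end $v$ of $e$. Consider the operator $\Delta:(u_e)\mapsto(u_e'')$ as an unbounded operator on $C([0,1];\mathbb C)^N$. Let $\Delta^{CK}$ be its restriction to those $u\in C^2([0,1];\mathbb C)^N$ such that $u_e(v)=u_{e'}(v)$ whenever $v$ is a common end of $e$ and $e'$, and $\sum_{e} d_{ve}\,u_e'(v)=0$ for all $v\in V$; let $\Delta^{KC}$ be its restriction to those $u\in C^2([0,1];\mathbb C)^N$ such that $\sum_{e} d_{ve}^2\,u_e(v)=0$ for all $v\in V$, and $d_{ve}\,u_e'(v)=d_{ve'}\,u_{e'}'(v)$ whenever $v$ is a common end of $e$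 and $e'$. Then the spectra of $-\Delta^{CK}$ and $-\Delta^{KC}$ coincide, counting (geometric) multiplicities of eigenvalues, if and only if $\Gamma$ is bipartite and unicyclic, i.e. contains exactly one circuit (a circuit being a connected subgraph that is regular of degree $2$). -/

import Mathlib

/-- The (metric) realization of a graph: every edge is identified with `[0,1]`. `tail e` is the
vertex at the parameter `0` of the edge `e`, and `head e` is the vertex at the parameter `1`. -/
structure EdgeParam {V : Type*} (G : SimpleGraph V) where
  tail : G.edgeSet → V
  head : G.edgeSet → V
  endpoints : ∀ e : G.edgeSet, (e : Sym2 V) = s(tail e, head e)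

/-- `G` is unicyclic: it contains exactly one circuit, a circuit being a connected
graph that is regular of degree two. -/
def IsUnicyclic {V : Type*} (G : SimpleGraph V) : Prop :=
  ∃! H : G.Subgraph, H.Connected ∧ ∀ v ∈ H.verts, (H.neighborSet v).ncard = 2

namespace UnboundedOp

variable {X : Type*} [AddCommGroup X] [Module ℂ X] [TopologicalSpace X]

/-- The resolvent set of an unbounded operator `A` on `X`: the complex numbers `z` such that
`A - z : D(A) → X` is a bijection with bounded inverse `R`. -/
def resolventSet (A : X →ₗ.[ℂ] X) : Set ℂ :=
  {z | ∃ R : X →L[ℂ] X,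
    (∀ f : X, ∃ h : R f ∈ A.domain, A ⟨R f, h⟩ - z • R f = f) ∧
    ∀ u : A.domain, R (A u - z • (u : X)) = u}

/-- The spectrum of an unbounded operator. -/
def spectrum (A : X →ₗ.[ℂ] X) : Set ℂ := (resolventSet A)ᶜ

/-- The eigenspace `ker (A - z)` of an unbounded operator. -/
def eigenspace (A : X →ₗ.[ℂ] X) (z : ℂ) : Submodule ℂ X :=
  (LinearMap.ker (A.toFun - z • A.domain.subtype)).map A.domain.subtype

/-- The spectra of `A` and `B` coincide, counting multiplicities. -/
def SameSpectrum (A B : X →ₗ.[ℂ] X) : Prop :=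
  spectrum A = spectrum B ∧
    ∀ z : ℂ, Module.rank ℂ (eigenspace A z) = Module.rank ℂ (eigenspace B z)

end UnboundedOp

noncomputable section

namespace QGraph

open Set

/-- The continuous functions `u = (u_e) : [0,1] → ℂ^N`, one component for each of the `N` edges. -/
abbrev NetFun {V : Type*} (G : SimpleGraph V) : Type _ := C(unitInterval, G.edgeSet → ℂ)

variable {V : Type*} {G : SimpleGraph V}

/-- The component `u_e`, as a function of a real variable (constant outside `[0,1]`; only its
values on `[0,1]` matter below). -/
def comp (u : NetFun G) (e : G.edgeSet) : ℝ → ℂ := fun x => u (projIcc 0 1 zero_le_one x) e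

/-- The derivative of `u_e` on `[0,1]` (one-sided at `0` and at `1`). -/
def edgeDeriv (u : NetFun G) (e : G.edgeSet) (x : ℝ) : ℂ :=
  derivWithin (comp u e) (Icc 0 1) x

/-- The second derivative of `u_e` on `[0,1]`. -/
def edgeDeriv₂ (u : NetFun G) (e : G.edgeSet) (x : ℝ) : ℂ :=
  derivWithin (edgeDeriv u e) (Icc 0 1) x

/-- All components of `u` are in `C²[0,1]`. -/
def IsC2 (u : NetFun G) : Prop := ∀ e, ContDiffOn ℝ 2 (comp u e) (Icc 0 1)

lemma IsC2.hasDeriv {u : NetFun G} (hu : IsC2 u) (e : G.edgeSet) {x : ℝ}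
    (hx : x ∈ Icc (0 : ℝ) 1) :
    HasDerivWithinAt (comp u e) (edgeDeriv u e x) (Icc 0 1) x :=
  (((hu e).differentiableOn (by norm_num)) x hx).hasDerivWithinAt

lemma IsC2.contDiffOn_deriv {u : NetFun G} (hu : IsC2 u) (e : G.edgeSet) :
    ContDiffOn ℝ 1 (edgeDeriv u e) (Icc 0 1) :=
  (hu e).derivWithin (uniqueDiffOn_Icc zero_lt_one) (by norm_num)

lemma IsC2.hasDeriv₂ {u : NetFun G} (hu : IsC2 u) (e : G.edgeSet) {x : ℝ}
    (hx : x ∈ Icc (0 : ℝ) 1) :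
    HasDerivWithinAt (edgeDeriv u e) (edgeDeriv₂ u e x) (Icc 0 1) x :=
  (((hu.contDiffOn_deriv e).differentiableOn (by norm_num)) x hx).hasDerivWithinAt

lemma IsC2.continuousOn_deriv₂ {u : NetFun G} (hu : IsC2 u) (e : G.edgeSet) :
    ContinuousOn (edgeDeriv₂ u e) (Icc 0 1) :=
  (hu.contDiffOn_deriv e).continuousOn_derivWithin (uniqueDiffOn_Icc zero_lt_one) (by norm_num)

lemma IsC2.zero : IsC2 (0 : NetFun G) := fun _ => contDiffOn_const

lemma IsC2.add {u w : NetFun G} (hu : IsC2 u) (hw : IsC2 w) : IsC2 (u + w) :=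
  fun e => (hu e).add (hw e)

lemma IsC2.smul (c : ℂ) {u : NetFun G} (hu : IsC2 u) : IsC2 (c • u) :=
  fun e => (contDiffOn_const (c := c)).mul (hu e)

lemma edgeDeriv_zero (e : G.edgeSet) (x : ℝ) : edgeDeriv (0 : NetFun G) e x = 0 := by
  have : comp (0 : NetFun G) e = fun _ => 0 := rfl
  simp [edgeDeriv, this]

lemma edgeDeriv_add {u w : NetFun G} (hu : IsC2 u) (hw : IsC2 w) (e : G.edgeSet) {x : ℝ}
    (hx : x ∈ Icc (0 : ℝ) 1) :
    edgeDeriv (u + w) e x = edgeDeriv u e x + edgeDeriv w e x :=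
  ((hu.hasDeriv e hx).add (hw.hasDeriv e hx)).derivWithin
    (uniqueDiffOn_Icc zero_lt_one x hx)

lemma edgeDeriv_smul (c : ℂ) {u : NetFun G} (hu : IsC2 u) (e : G.edgeSet) {x : ℝ}
    (hx : x ∈ Icc (0 : ℝ) 1) : edgeDeriv (c • u) e x = c * edgeDeriv u e x :=
  ((hu.hasDeriv e hx).const_mul c).derivWithin (uniqueDiffOn_Icc zero_lt_one x hx)

lemma edgeDeriv₂_add {u w : NetFun G} (hu : IsC2 u) (hw : IsC2 w) (e : G.edgeSet) {x : ℝ}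
    (hx : x ∈ Icc (0 : ℝ) 1) :
    edgeDeriv₂ (u + w) e x = edgeDeriv₂ u e x + edgeDeriv₂ w e x :=
  (((hu.hasDeriv₂ e hx).add (hw.hasDeriv₂ e hx)).congr
    (fun _ hy => edgeDeriv_add hu hw e hy) (edgeDeriv_add hu hw e hx)).derivWithin
    (uniqueDiffOn_Icc zero_lt_one x hx)

lemma edgeDeriv₂_smul (c : ℂ) {u : NetFun G} (hu : IsC2 u) (e : G.edgeSet) {x : ℝ}
    (hx : x ∈ Icc (0 : ℝ) 1) : edgeDeriv₂ (c • u) e x = c * edgeDeriv₂ u e x :=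
  (((hu.hasDeriv₂ e hx).const_mul c).congr
    (fun _ hy => edgeDeriv_smul c hu e hy) (edgeDeriv_smul c hu e hx)).derivWithin
    (uniqueDiffOn_Icc zero_lt_one x hx)

/-- The subspace `C²[0,1]^N` of `C[0,1]^N`. -/
def C2 (G : SimpleGraph V) : Submodule ℂ (NetFun G) where
  carrier := {u | IsC2 u}
  zero_mem' := IsC2.zero
  add_mem' := IsC2.add
  smul_mem' c _ hu := IsC2.smul c hu

/-- The Laplacian `(u_e) ↦ (u_e'')` from `C²[0,1]^N` to `C[0,1]^N`, as an unbounded operator on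
`C[0,1]^N`. -/
def laplacian (G : SimpleGraph V) : NetFun G →ₗ.[ℂ] NetFun G where
  domain := C2 G
  toFun :=
    { toFun := fun u =>
        { toFun := fun x e => edgeDeriv₂ u.1 e x
          continuous_toFun := continuous_pi fun e =>
            continuousOn_iff_continuous_domRestrict.1 (IsC2.continuousOn_deriv₂ u.2 e) }
      map_add' := fun u w => by
        ext x e
        exact edgeDeriv₂_add u.2 w.2 e x.2
      map_smul' := fun c u => by
        ext x e
        exact edgeDeriv₂_smul c u.2 e x.2 }

section

variable [DecidableEq V]

/-- The entry `d_{v,e}` of the signed incidence matrix: `1` if `v` is the head of `e`, `-1` if `v`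
is the tail of `e`, and `0` otherwise. -/
def incidence (P : EdgeParam G) (v : V) (e : G.edgeSet) : ℂ :=
  if v = P.head e then 1 else if v = P.tail e then -1 else 0

/-- The parameter in `[0,1]` at which the vertex `v` lies on the edge `e` (meaningful only if `v`
is an end of `e`). -/
def pos (P : EdgeParam G) (v : V) (e : G.edgeSet) : unitInterval :=
  if v = P.head e then 1 else 0

variable [Fintype G.edgeSet]

/-- Continuity at the vertices, together with the Kirchhoff flow condition. -/
def CKCondition (P : EdgeParam G) (u : NetFun G) : Prop :=
  (∀ (v : V) (e e' : G.edgeSet), v ∈ (e : Sym2 V) → v ∈ (e' : Sym2 V) →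
      u (pos P v e) e = u (pos P v e') e') ∧
  ∀ v : V, ∑ e : G.edgeSet, incidence P v e * edgeDeriv u e (pos P v e) = 0

/-- The anti-Kirchhoff condition: at every vertex the values sum up to zero, and the outer normal
derivatives agree. -/
def KCCondition (P : EdgeParam G) (u : NetFun G) : Prop :=
  (∀ v : V, ∑ e : G.edgeSet, incidence P v e ^ 2 * u (pos P v e) e = 0) ∧
  ∀ (v : V) (e e' : G.edgeSet), v ∈ (e : Sym2 V) → v ∈ (e' : Sym2 V) →
      incidence P v e * edgeDeriv u e (pos P v e) =
        incidence P v e' * edgeDeriv u e' (pos P v e')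

/-- The functions in `C²[0,1]^N` that satisfy the CK-condition. -/
def domainCK (P : EdgeParam G) : Submodule ℂ (NetFun G) where
  carrier := {u | IsC2 u ∧ CKCondition P u}
  zero_mem' := ⟨IsC2.zero, fun _ _ _ _ _ => rfl, fun v => by simp [edgeDeriv_zero]⟩
  add_mem' := by
    rintro u w ⟨hu, hu1, hu2⟩ ⟨hw, hw1, hw2⟩
    refine ⟨hu.add hw, fun v e e' h h' => ?_, fun v => ?_⟩
    · exact congrArg₂ (· + ·) (hu1 v e e' h h') (hw1 v e e' h h')
    · simp only [edgeDeriv_add hu hw _ (pos P v _).2, mul_add, Finset.sum_add_distrib, hu2, hw2,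
        add_zero]
  smul_mem' := by
    rintro c u ⟨hu, hu1, hu2⟩
    refine ⟨hu.smul c, fun v e e' h h' => ?_, fun v => ?_⟩
    · exact congrArg (c * ·) (hu1 v e e' h h')
    · simp only [edgeDeriv_smul c hu _ (pos P v _).2, mul_left_comm _ c, ← Finset.mul_sum, hu2,
        mul_zero]

/-- The functions in `C²[0,1]^N` that satisfy the KC-condition. -/
def domainKC (P : EdgeParam G) : Submodule ℂ (NetFun G) where
  carrier := {u | IsC2 u ∧ KCCondition P u}
  zero_mem' := ⟨IsC2.zero, fun v => by simp, fun v e e' _ _ => by simp [edgeDeriv_zero]⟩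
  add_mem' := by
    rintro u w ⟨hu, hu1, hu2⟩ ⟨hw, hw1, hw2⟩
    refine ⟨hu.add hw, fun v => ?_, fun v e e' h h' => ?_⟩
    · simp only [ContinuousMap.add_apply, Pi.add_apply, mul_add, Finset.sum_add_distrib, hu1, hw1,
        add_zero]
    · simp only [edgeDeriv_add hu hw _ (pos P v _).2, mul_add, hu2 v e e' h h', hw2 v e e' h h']
  smul_mem' := by
    rintro c u ⟨hu, hu1, hu2⟩
    refine ⟨hu.smul c, fun v => ?_, fun v e e' h h' => ?_⟩
    · simp only [ContinuousMap.smul_apply, Pi.smul_apply, smul_eq_mul, mul_left_comm _ c,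
        ← Finset.mul_sum, hu1, mul_zero]
    · simp only [edgeDeriv_smul c hu _ (pos P v _).2, mul_left_comm _ c, hu2 v e e' h h']

/-- The Laplacian with the CK-condition. -/
def laplacianCK (P : EdgeParam G) : NetFun G →ₗ.[ℂ] NetFun G :=
  (laplacian G).domRestrict (domainCK P)

/-- The Laplacian with the KC-condition. -/
def laplacianKC (P : EdgeParam G) : NetFun G →ₗ.[ℂ] NetFun G :=
  (laplacian G).domRestrict (domainKC P)

end

end QGraph

end

/-! ### Edgewise calculus and solutions of `u'' = -z u` -/

noncomputable section

namespace QGraph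

open Set

variable {V : Type*} {G : SimpleGraph V}

/-! Only multiplicities of eigenvalues matter. Solutions of `u'' = -z u` depend on two constants per
edge, and each vertex condition imposes as many linear constraints: the traces of `u` and the signed
traces of `u'` at the `2N` ends must lie in `constantEnds` and `balancedEnds`, in this order for CK
and interchanged for KC, and these two spaces have complementary dimensions. If `z` is not an
eigenvalue, the boundary problem is therefore uniquely solvable, with a bounded solution operator
(`mem_resolventSet_of_eigenspace_eq_bot`).

Suppose that the graph is bipartite, with signs `σ = ±1` alternating along edges. Then `u ↦ σ u'`,
with `σ` read off at the head of each edge, turns traces into signed traces up to a factor depending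
only on the vertex. It thus interchanges the two conditions, and it is injective on eigenfunctions
for `z ≠ 0` (`rank_eigenspace_eq_of_ne_zero`). Only `z = 0` remains: the CK-kernel consists of the
constants, while the KC-kernel is a copy of the cycle space, of dimension `#E - #V + 1`. They agree
in dimension exactly when `#E = #V`, which for a connected graph means being unicyclic
(`isUnicyclic_iff`).

Suppose that the graph is not bipartite, and take `z = π²`. CK-eigenfunctions change sign along each
edge, hence vanish at all vertices; they are sines whose amplitudes lie in the kernel of the
unsigned incidence matrix, of dimension `#E - #V`. KC admits cosines with amplitudes in the cycle
space and one common sine, so its multiplicity is at least `#E - #V + 2`, and the spectra differ. -/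

lemma comp_of_mem (u : NetFun G) (e : G.edgeSet) {x : ℝ} (hx : x ∈ Icc (0 : ℝ) 1) :
    comp u e x = u ⟨x, hx⟩ e := by
  simp [comp, projIcc_of_mem _ hx]

lemma comp_coe (u : NetFun G) (e : G.edgeSet) (x : unitInterval) : comp u e x = u x e :=
  comp_of_mem u e x.2

lemma continuous_comp (u : NetFun G) (e : G.edgeSet) : Continuous (comp u e) :=
  (continuous_apply e).comp (u.continuous.comp continuous_projIcc)

/-- `u'` is the (edgewise) derivative of `u`. -/
def IsDeriv (u u' : NetFun G) : Prop :=
  ∀ e, ∀ x ∈ Icc (0 : ℝ) 1, HasDerivWithinAt (comp u e) (comp u' e x) (Icc 0 1) x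

lemma IsDeriv.of_hasDerivAt {u u' : NetFun G} (p : G.edgeSet → ℝ → ℂ)
    (hu : ∀ e (x : unitInterval), u x e = p e x)
    (hp : ∀ e (x : unitInterval), HasDerivAt (p e) (u' x e) x) : IsDeriv u u' := by
  intro e x hx
  have h := (hp e ⟨x, hx⟩).hasDerivWithinAt (s := Icc 0 1)
  rw [comp_of_mem u' e hx]
  exact h.congr (fun y hy => by rw [comp_of_mem u e hy, hu]) (by rw [comp_of_mem u e hx, hu])

lemma IsDeriv.add {u u' w w' : NetFun G} (hu : IsDeriv u u') (hw : IsDeriv w w') :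
    IsDeriv (u + w) (u' + w') := fun e x hx => (hu e x hx).add (hw e x hx)

lemma IsDeriv.neg {u u' : NetFun G} (hu : IsDeriv u u') : IsDeriv (-u) (-u') :=
  fun e x hx => (hu e x hx).neg

lemma IsDeriv.sub {u u' w w' : NetFun G} (hu : IsDeriv u u') (hw : IsDeriv w w') :
    IsDeriv (u - w) (u' - w') := fun e x hx => (hu e x hx).sub (hw e x hx)

lemma IsDeriv.smul (c : ℂ) {u u' : NetFun G} (hu : IsDeriv u u') : IsDeriv (c • u) (c • u') :=
  fun e x hx => (hu e x hx).const_mul c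

lemma IsDeriv.mul {u u' w w' : NetFun G} (hu : IsDeriv u u') (hw : IsDeriv w w') :
    IsDeriv (u * w) (u' * w + u * w') := fun e x hx => (hu e x hx).mul (hw e x hx)

lemma isDeriv_const (a : G.edgeSet → ℂ) : IsDeriv (ContinuousMap.const unitInterval a) 0 :=
  fun _ _ _ => hasDerivWithinAt_const ..

lemma IsDeriv.const_mul (a : G.edgeSet → ℂ) {u u' : NetFun G} (hu : IsDeriv u u') :
    IsDeriv (ContinuousMap.const unitInterval a * u) (ContinuousMap.const unitInterval a * u') := by
  simpa using (isDeriv_const a).mul hu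

lemma IsDeriv.mul_const (a : G.edgeSet → ℂ) {u u' : NetFun G} (hu : IsDeriv u u') :
    IsDeriv (u * ContinuousMap.const unitInterval a) (u' * ContinuousMap.const unitInterval a) := by
  simpa using hu.mul (isDeriv_const a)

lemma IsDeriv.edgeDeriv_eq {u u' : NetFun G} (hu : IsDeriv u u') (e : G.edgeSet) {x : ℝ}
    (hx : x ∈ Icc (0 : ℝ) 1) : edgeDeriv u e x = comp u' e x :=
  (hu e x hx).derivWithin (uniqueDiffOn_Icc zero_lt_one x hx)

lemma IsDeriv.edgeDeriv₂_eq {u u' u'' : NetFun G} (hu : IsDeriv u u') (hu' : IsDeriv u' u'')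
    (e : G.edgeSet) {x : ℝ} (hx : x ∈ Icc (0 : ℝ) 1) : edgeDeriv₂ u e x = comp u'' e x :=
  ((hu' e x hx).congr (fun _ hy => hu.edgeDeriv_eq e hy) (hu.edgeDeriv_eq e hx)).derivWithin
    (uniqueDiffOn_Icc zero_lt_one x hx)

lemma IsDeriv.unique {u v w : NetFun G} (hv : IsDeriv u v) (hw : IsDeriv u w) : v = w := by
  ext x e
  rw [← comp_coe, ← comp_coe, ← hv.edgeDeriv_eq e x.2, ← hw.edgeDeriv_eq e x.2]

lemma IsDeriv.eq_const {u : NetFun G} (hu : IsDeriv u 0) :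
    u = ContinuousMap.const unitInterval (u 0) := by
  ext x e
  have h := constant_of_derivWithin_zero (f := comp u e) (a := 0) (b := 1)
    (fun y hy => (hu e y hy).differentiableWithinAt)
    (fun y hy => hu.edgeDeriv_eq e (Ico_subset_Icc_self hy)) x x.2
  rw [comp_coe] at h
  rw [h, comp_of_mem u e (left_mem_Icc.2 zero_le_one)]
  rfl

/-- Continuity of the derivatives is built into `NetFun`, so a chain of two `IsDeriv` is all of
`C²`; later proofs never return to `derivWithin`. -/
lemma isC2_iff {u : NetFun G} : IsC2 u ↔ ∃ u' u'', IsDeriv u u' ∧ IsDeriv u' u'' := by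
  constructor
  · intro hu
    have h1 : Continuous fun (x : unitInterval) (e : G.edgeSet) => edgeDeriv u e x :=
      continuous_pi fun e =>
        continuousOn_iff_continuous_domRestrict.1 (hu.contDiffOn_deriv e).continuousOn
    have h2 : Continuous fun (x : unitInterval) (e : G.edgeSet) => edgeDeriv₂ u e x :=
      continuous_pi fun e =>
        continuousOn_iff_continuous_domRestrict.1 (hu.continuousOn_deriv₂ e)
    refine ⟨⟨_, h1⟩, ⟨_, h2⟩, fun e x hx => ?_, fun e x hx => ?_⟩
    · rw [comp_of_mem _ _ hx]
      exact hu.hasDeriv e hx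
    · rw [comp_of_mem _ _ hx]
      exact (hu.hasDeriv₂ e hx).congr (fun y hy => comp_of_mem _ _ hy) (comp_of_mem _ _ hx)
  · rintro ⟨u', u'', h1, h2⟩ e
    have hud := uniqueDiffOn_Icc (zero_lt_one (α := ℝ))
    have h3 : ContDiffOn ℝ 1 (derivWithin (comp u e) (Icc 0 1)) (Icc 0 1) := by
      have : ContDiffOn ℝ (0 + 1) (derivWithin (comp u e) (Icc 0 1)) (Icc 0 1) := by
        rw [contDiffOn_succ_iff_derivWithin hud]
        refine ⟨fun x hx => ?_, by simp, ?_⟩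
        · exact ((h2 e x hx).congr (fun y hy => h1.edgeDeriv_eq e hy)
            (h1.edgeDeriv_eq e hx)).differentiableWithinAt
        · rw [contDiffOn_zero]
          exact (continuous_comp u'' e).continuousOn.congr
            fun x hx => h1.edgeDeriv₂_eq h2 e hx
      simpa using this
    have : ContDiffOn ℝ (1 + 1) (comp u e) (Icc 0 1) := by
      rw [contDiffOn_succ_iff_derivWithin hud]
      exact ⟨fun x hx => (h1 e x hx).differentiableWithinAt, by simp, h3⟩
    rwa [one_add_one_eq_two] at this

/-- The Laplacian in terms of `IsDeriv`. -/
lemma laplacian_domRestrict_iff (D : Submodule ℂ (NetFun G)) (hD : ∀ u ∈ D, IsC2 u)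
    (u w : NetFun G) :
    (∃ h : u ∈ (-(laplacian G).domRestrict D).domain,
        (-(laplacian G).domRestrict D) ⟨u, h⟩ = w) ↔
      u ∈ D ∧ ∃ u', IsDeriv u u' ∧ IsDeriv u' (-w) := by
  have key : ∀ (h : u ∈ (-(laplacian G).domRestrict D).domain) (u' u'' : NetFun G),
      IsDeriv u u' → IsDeriv u' u'' → (-(laplacian G).domRestrict D) ⟨u, h⟩ = -u'' := by
    intro h u' u'' h1 h2
    rw [LinearPMap.neg_apply, neg_inj]
    ext x e
    exact (h1.edgeDeriv₂_eq h2 e x.2).trans (comp_coe _ _ _)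
  constructor
  · rintro ⟨h, rfl⟩
    have hu : u ∈ D := h.1
    obtain ⟨u', u'', h1, h2⟩ := isC2_iff.1 (hD u hu)
    refine ⟨hu, u', h1, ?_⟩
    rw [key h u' u'' h1 h2, neg_neg]
    exact h2
  · rintro ⟨hu, u', h1, h2⟩
    refine ⟨⟨hu, hD u hu⟩, ?_⟩
    exact (key _ u' _ h1 h2).trans (neg_neg w)

/-- `C` and `S` form the standard fundamental system of `u'' = - z u` on every edge. -/
structure IsFundamental (z : ℂ) (C S : NetFun G) : Prop where
  derivC : IsDeriv C (-(z • S))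
  derivS : IsDeriv S C
  C_zero : C 0 = 1
  S_zero : S 0 = 0

/-- The derivative of the left side cancels, and its value at `0` is `1`. -/
lemma IsFundamental.wronskian {z : ℂ} {C S : NetFun G} (h : IsFundamental z C S) :
    C * C + z • (S * S) = 1 := by
  have h1 := (h.derivC.mul h.derivC).add ((h.derivS.mul h.derivS).smul z)
  have h2 : -(z • S) * C + C * -(z • S) + z • (C * S + S * C) = 0 := by
    ext x e
    simp
  rw [h2] at h1
  rw [h1.eq_const]
  ext x e
  simp [h.C_zero, h.S_zero]

/-- Every solution of `u'' = - z u` is determined by its Cauchy data at `0`. -/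
lemma IsFundamental.eq {z : ℂ} {C S : NetFun G} (h : IsFundamental z C S) {u u' : NetFun G}
    (h1 : IsDeriv u u') (h2 : IsDeriv u' (-(z • u))) :
    u = C * ContinuousMap.const unitInterval (u 0) + S * ContinuousMap.const unitInterval (u' 0) := by
  -- The combinations `α = C u - S u'` and `β = z S u + C u'` have derivative zero, so they equal `u
  -- 0` and `u' 0`; the Wronskian identity then gives `u = C α + S β`.
  have hα := (h.derivC.mul h1).sub (h.derivS.mul h2)
  have hβ := ((h.derivS.mul h1).smul z).add (h.derivC.mul h2)
  have eα : -(z • S) * u + C * u' - (C * u' + S * -(z • u)) = 0 := by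
    ext x e
    simp
    ring
  have eβ : z • (C * u + S * u') + (-(z • S) * u' + C * -(z • u)) = 0 := by
    ext x e
    simp
  rw [eα] at hα
  rw [eβ] at hβ
  have a := hα.eq_const
  have b := hβ.eq_const
  have W := h.wronskian
  ext x e
  have a' := congrFun (DFunLike.congr_fun a x) e
  have b' := congrFun (DFunLike.congr_fun b x) e
  have W' := congrFun (DFunLike.congr_fun W x) e
  simp [h.C_zero, h.S_zero] at a' b' W'
  simp only [ContinuousMap.add_apply, ContinuousMap.mul_apply, ContinuousMap.const_apply,
    Pi.add_apply, Pi.mul_apply]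
  rw [← a', ← b']
  linear_combination (-u x e) * W'

lemma IsFundamental.eq_deriv {z : ℂ} {C S : NetFun G} (h : IsFundamental z C S) {u u' : NetFun G}
    (h1 : IsDeriv u u') (h2 : IsDeriv u' (-(z • u))) :
    u' = -(z • S) * ContinuousMap.const unitInterval (u 0) +
      C * ContinuousMap.const unitInterval (u' 0) := by
  have := (h.derivC.mul_const (u 0)).add (h.derivS.mul_const (u' 0))
  rw [← h.eq h1 h2] at this
  exact h1.unique this

/-- The cosine on every edge. -/
def cosFun (G : SimpleGraph V) (ω : ℂ) : NetFun G where
  toFun x _ := Complex.cos (ω * (x : ℝ))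
  continuous_toFun := by fun_prop

/-- The normalized sine on every edge. -/
def sinFun (G : SimpleGraph V) (ω : ℂ) : NetFun G where
  toFun x _ := Complex.sin (ω * (x : ℝ)) / ω
  continuous_toFun := by fun_prop

lemma isFundamental_cos_sin {ω : ℂ} (hω : ω ≠ 0) :
    IsFundamental (ω ^ 2) (cosFun G ω) (sinFun G ω) := by
  have hl : ∀ x : ℝ, HasDerivAt (fun y : ℝ => ω * (y : ℂ)) ω x := fun x => by
    simpa using (Complex.ofRealCLM.hasDerivAt (x := x)).const_mul ω
  constructor
  · refine IsDeriv.of_hasDerivAt (fun _ x => Complex.cos (ω * x)) (fun _ _ => rfl) fun e x => ?_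
    refine ((Complex.hasDerivAt_cos _).comp_of_eq (x : ℝ) (hl x) rfl).congr_deriv ?_
    change _ = -(ω ^ 2 * (Complex.sin (ω * (x : ℝ)) / ω))
    field_simp
  · refine IsDeriv.of_hasDerivAt (fun _ x => Complex.sin (ω * x) / ω) (fun _ _ => rfl)
      fun e x => ?_
    refine (((Complex.hasDerivAt_sin _).comp_of_eq (x : ℝ) (hl x) rfl).div_const ω).congr_deriv ?_
    change _ = Complex.cos (ω * (x : ℝ))
    field_simp
  · ext e; simp [cosFun]
  · ext e; simp [sinFun]

/-- The parameter itself on every edge. -/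
def idFun (G : SimpleGraph V) : NetFun G where
  toFun x _ := (x : ℝ)
  continuous_toFun := by fun_prop

lemma isFundamental_zero : IsFundamental 0 (1 : NetFun G) (idFun G) := by
  constructor
  · have : -((0 : ℂ) • idFun G) = 0 := by
      ext x e
      simp
    rw [this]
    exact isDeriv_const (G := G) 1
  · refine IsDeriv.of_hasDerivAt (fun _ x => (x : ℂ)) (fun _ _ => rfl) fun e x => ?_
    exact Complex.ofRealCLM.hasDerivAt (x := (x : ℝ))
  · rfl
  · ext e; simp [idFun]

lemma exists_isFundamental (z : ℂ) : ∃ C S : NetFun G, IsFundamental z C S := by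
  rcases eq_or_ne z 0 with rfl | hz
  · exact ⟨_, _, isFundamental_zero⟩
  · obtain ⟨ω, rfl⟩ := IsAlgClosed.exists_pow_nat_eq z (n := 2) two_pos
    exact ⟨_, _, isFundamental_cos_sin (by rintro rfl; simp at hz)⟩

/-! ### Variation of constants -/

section

variable [Fintype G.edgeSet]

/-- Integration from `0` on every edge. -/
def primitive (G : SimpleGraph V) [Fintype G.edgeSet] : NetFun G →L[ℂ] NetFun G :=
  LinearMap.mkContinuous
    { toFun := fun f =>
        { toFun := fun x e => ∫ t in (0 : ℝ)..x, comp f e t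
          continuous_toFun := continuous_pi fun e =>
            (intervalIntegral.continuous_primitive
              (fun a b => (continuous_comp f e).intervalIntegrable a b) 0).comp
              continuous_subtype_val }
      map_add' := fun f g => by
        ext x e
        exact intervalIntegral.integral_add ((continuous_comp f e).intervalIntegrable _ _)
          ((continuous_comp g e).intervalIntegrable _ _)
      map_smul' := fun c f => by
        ext x e
        exact intervalIntegral.integral_const_mul c _ } 1 (by
    intro f
    rw [one_mul, ContinuousMap.norm_le _ (norm_nonneg _)]
    intro x
    rw [pi_norm_le_iff_of_nonneg (norm_nonneg _)]
    intro e
    refine (intervalIntegral.norm_integral_le_of_norm_le_const (C := ‖f‖) fun t _ =>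
      (norm_le_pi_norm _ e).trans (f.norm_coe_le_norm _)).trans ?_
    rw [sub_zero, abs_of_nonneg x.2.1]
    exact mul_le_of_le_one_right (norm_nonneg _) x.2.2)

lemma isDeriv_primitive (f : NetFun G) : IsDeriv (primitive G f) f := by
  refine IsDeriv.of_hasDerivAt (fun e x => ∫ t in (0 : ℝ)..x, comp f e t) (fun _ _ => rfl)
    fun e x => ?_
  rw [← comp_coe]
  exact ((continuous_comp f e).integral_hasStrictDerivAt 0 x).hasDerivAt

/-- Variation of constants: a solution operator of `u'' = - z u + f`. -/
def duhamel (C S : NetFun G) : NetFun G →L[ℂ] NetFun G :=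
  ContinuousLinearMap.mul ℂ _ S ∘L primitive G ∘L ContinuousLinearMap.mul ℂ _ C -
    ContinuousLinearMap.mul ℂ _ C ∘L primitive G ∘L ContinuousLinearMap.mul ℂ _ S

/-- The derivative of `duhamel`. -/
def duhamelDeriv (z : ℂ) (C S : NetFun G) : NetFun G →L[ℂ] NetFun G :=
  ContinuousLinearMap.mul ℂ _ C ∘L primitive G ∘L ContinuousLinearMap.mul ℂ _ C +
    z • (ContinuousLinearMap.mul ℂ _ S ∘L primitive G ∘L ContinuousLinearMap.mul ℂ _ S)

/-- The terms in which the integrals are differentiated, `S C f` and `C S f`, cancel. -/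
lemma IsFundamental.isDeriv_duhamel {z : ℂ} {C S : NetFun G} (h : IsFundamental z C S)
    (f : NetFun G) : IsDeriv (duhamel C S f) (duhamelDeriv z C S f) := by
  have := (h.derivS.mul (isDeriv_primitive (C * f))).sub
    (h.derivC.mul (isDeriv_primitive (S * f)))
  have e1 : C * primitive G (C * f) + S * (C * f) -
      (-(z • S) * primitive G (S * f) + C * (S * f)) = duhamelDeriv z C S f := by
    change _ = C * primitive G (C * f) + z • (S * primitive G (S * f))
    ext x e
    simp
    ring
  rw [e1] at this
  exact this

/-- Here differentiating the integrals leaves `(C² + z S²) f`, which is `f` by the Wronskian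
identity. -/
lemma IsFundamental.isDeriv_duhamelDeriv {z : ℂ} {C S : NetFun G} (h : IsFundamental z C S)
    (f : NetFun G) : IsDeriv (duhamelDeriv z C S f) (-(z • duhamel C S f) + f) := by
  have := (h.derivC.mul (isDeriv_primitive (C * f))).add
    ((h.derivS.mul (isDeriv_primitive (S * f))).smul z)
  have e1 : -(z • S) * primitive G (C * f) + C * (C * f) +
      z • (C * primitive G (S * f) + S * (S * f)) = -(z • duhamel C S f) + f := by
    change _ = -(z • (S * primitive G (C * f) - C * primitive G (S * f))) + f
    ext x e
    have W' := congrFun (DFunLike.congr_fun h.wronskian x) e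
    simp at W' ⊢
    linear_combination f x e * W'
  rw [e1] at this
  exact this

end

end QGraph

end

/-! ### The spectrum consists of eigenvalues -/

noncomputable section

namespace UnboundedOp

lemma mem_eigenspace {X : Type*} [AddCommGroup X] [Module ℂ X] (A : X →ₗ.[ℂ] X) (z : ℂ) (u : X) :
    u ∈ eigenspace A z ↔ ∃ h : u ∈ A.domain, A ⟨u, h⟩ = z • u := by
  simp only [eigenspace, Submodule.mem_map, LinearMap.mem_ker]
  constructor
  · rintro ⟨⟨w, hw⟩, h, rfl⟩
    exact ⟨hw, sub_eq_zero.1 h⟩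
  · rintro ⟨hu, h⟩
    exact ⟨⟨u, hu⟩, sub_eq_zero.2 h, rfl⟩

lemma eigenspace_eq_bot_of_mem_resolventSet {X : Type*} [AddCommGroup X] [Module ℂ X]
    [TopologicalSpace X] (A : X →ₗ.[ℂ] X) {z : ℂ} (hz : z ∈ resolventSet A) :
    eigenspace A z = ⊥ := by
  obtain ⟨R, -, hR⟩ := hz
  rw [Submodule.eq_bot_iff]
  intro u hu
  obtain ⟨h, hu⟩ := (mem_eigenspace A z u).1 hu
  have := hR ⟨u, h⟩
  rw [hu, sub_self, map_zero] at this
  exact this.symm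

end UnboundedOp

namespace QGraph

open Set Module

variable {V : Type*} {G : SimpleGraph V}

/-- The ends of the edges: `(e, true)` is the end of `e` at the parameter `1`, and `(e, false)`
is the end at the parameter `0`. -/
abbrev EdgeEnd (G : SimpleGraph V) : Type _ := G.edgeSet × Bool

/-- The parameter of an end. -/
def EdgeEnd.param (i : EdgeEnd G) : unitInterval := if i.2 then 1 else 0

/-- The sign of an end. -/
def EdgeEnd.sign (i : EdgeEnd G) : ℂ := if i.2 then 1 else -1

/-- The vertex at an end. -/
def EdgeEnd.vertex (P : EdgeParam G) (i : EdgeEnd G) : V := if i.2 then P.head i.1 else P.tail i.1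

/-- The values at the ends of the edges. -/
def trace (G : SimpleGraph V) : NetFun G →L[ℂ] (EdgeEnd G → ℂ) :=
  ContinuousLinearMap.pi fun i =>
    (ContinuousLinearMap.proj i.1).comp (ContinuousMap.evalCLM ℂ i.param)

/-- The values at the ends of the edges, with signs. -/
def signedTrace (G : SimpleGraph V) : NetFun G →L[ℂ] (EdgeEnd G → ℂ) :=
  ContinuousLinearMap.pi fun i =>
    i.sign • (ContinuousLinearMap.proj i.1).comp (ContinuousMap.evalCLM ℂ i.param)

lemma signedTrace_apply (u : NetFun G) (i : EdgeEnd G) :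
    signedTrace G u i = i.sign * u i.param i.1 := rfl

/-- The linear combination of a fundamental system with given coefficients. -/
def combination (C S : NetFun G) : (G.edgeSet → ℂ) × (G.edgeSet → ℂ) →ₗ[ℂ] NetFun G where
  toFun p := C * ContinuousMap.const unitInterval p.1 + S * ContinuousMap.const unitInterval p.2
  map_add' p q := by
    ext x e
    simp
    ring
  map_smul' c p := by
    ext x e
    simp

variable [Fintype G.edgeSet]

/-- The second derivative operator with boundary conditions `trace u ∈ W₁`, `signedTrace u' ∈ W₂`
of the right total dimension has discrete spectrum. -/
theorem mem_resolventSet_of_eigenspace_eq_bot (A : NetFun G →ₗ.[ℂ] NetFun G)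
    (W₁ W₂ : Submodule ℂ (EdgeEnd G → ℂ))
    (hW : finrank ℂ W₁ + finrank ℂ W₂ = Fintype.card (EdgeEnd G))
    (hA : ∀ u w, (∃ h : u ∈ A.domain, A ⟨u, h⟩ = w) ↔
      ∃ u', IsDeriv u u' ∧ IsDeriv u' (-w) ∧ trace G u ∈ W₁ ∧ signedTrace G u' ∈ W₂)
    {z : ℂ} (hz : UnboundedOp.eigenspace A z = ⊥) : z ∈ UnboundedOp.resolventSet A := by
  obtain ⟨C, S, h⟩ := exists_isFundamental (G := G) z
  have hsol : ∀ p, IsDeriv (combination C S p) (combination (-(z • S)) C p) := fun p =>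
    (h.derivC.mul_const p.1).add (h.derivS.mul_const p.2)
  have hsol' : ∀ p, IsDeriv (combination (-(z • S)) C p) (-(z • combination C S p)) := by
    intro p
    have := ((h.derivS.smul z).neg.mul_const p.1).add (h.derivC.mul_const p.2)
    have e1 : -(z • C) * ContinuousMap.const unitInterval p.1 +
        -(z • S) * ContinuousMap.const unitInterval p.2 = -(z • combination C S p) := by
      ext x e
      simp [combination]
      ring
    rwa [e1] at this
  have hinj : ∀ u, (∃ h : u ∈ A.domain, A ⟨u, h⟩ = z • u) → u = 0 := fun u hu => by
    have := (UnboundedOp.mem_eigenspace A z u).2 hu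
    rwa [hz, Submodule.mem_bot] at this
  -- `T` sends Cauchy data at `0` to the defect of the homogeneous solution in the boundary
  -- conditions. Its kernel consists of data of eigenfunctions, so it is injective, and `hW` makes
  -- it bijective.
  let T : (G.edgeSet → ℂ) × (G.edgeSet → ℂ) →ₗ[ℂ]
      ((EdgeEnd G → ℂ) ⧸ W₁) × ((EdgeEnd G → ℂ) ⧸ W₂) :=
    (W₁.mkQ ∘ₗ (trace G).toLinearMap ∘ₗ combination C S).prod
      (W₂.mkQ ∘ₗ (signedTrace G).toLinearMap ∘ₗ combination (-(z • S)) C)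
  have hT : Function.Injective T := by
    rw [← LinearMap.ker_eq_bot, LinearMap.ker_eq_bot']
    intro p hp
    have h1 := (Submodule.Quotient.mk_eq_zero W₁).1 (congrArg Prod.fst hp)
    have h2 := (Submodule.Quotient.mk_eq_zero W₂).1 (congrArg Prod.snd hp)
    have h0 : combination C S p = 0 := hinj _ ((hA _ _).2 ⟨_, hsol p, hsol' p, h1, h2⟩)
    have h0' : combination (-(z • S)) C p = 0 := by
      have := hsol p
      rw [h0] at this
      exact this.unique (isDeriv_const 0)
    have e0 := DFunLike.congr_fun h0 0
    have e0' := DFunLike.congr_fun h0' 0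
    simp [combination, h.C_zero, h.S_zero] at e0 e0'
    exact Prod.ext e0 e0'
  have hdim : finrank ℂ ((G.edgeSet → ℂ) × (G.edgeSet → ℂ)) =
      finrank ℂ (((EdgeEnd G → ℂ) ⧸ W₁) × ((EdgeEnd G → ℂ) ⧸ W₂)) := by
    have h1 := W₁.finrank_quotient_add_finrank
    have h2 := W₂.finrank_quotient_add_finrank
    simp only [finrank_prod, finrank_fintype_fun_eq_card] at h1 h2 ⊢
    have h3 : Fintype.card (EdgeEnd G) = Fintype.card G.edgeSet * 2 := by simp [EdgeEnd]
    omega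
  let T' := LinearEquiv.ofInjectiveOfFinrankEq T hT hdim
  have hT' : ∀ y, T (T'.symm y) = y := T'.apply_symm_apply
  let Φ : (EdgeEnd G → ℂ) × (EdgeEnd G → ℂ) →ₗ[ℂ] NetFun G :=
    combination C S ∘ₗ T'.symm.toLinearMap ∘ₗ W₁.mkQ.prodMap W₂.mkQ
  -- A homogeneous solution corrects the boundary values of the Duhamel term. The minus sign arises
  -- because `A` is minus the second derivative: the equation to solve is `u'' = -z u - f`.
  -- Boundedness of the correction is automatic, as `Φ` starts from a finite-dimensional space.
  let R : NetFun G →L[ℂ] NetFun G := Φ.toContinuousLinearMap ∘L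
    ((trace G ∘L duhamel C S).prod (signedTrace G ∘L duhamelDeriv z C S)) - duhamel C S
  have hR : ∀ f : NetFun G, ∃ h : R f ∈ A.domain, A ⟨R f, h⟩ = z • R f + f := by
    intro f
    rw [hA]
    set p := T'.symm (W₁.mkQ (trace G (duhamel C S f)), W₂.mkQ (signedTrace G (duhamelDeriv z C S f)))
      with hp
    have hTp := hT' (W₁.mkQ (trace G (duhamel C S f)),
      W₂.mkQ (signedTrace G (duhamelDeriv z C S f)))
    rw [← hp] at hTp
    have hRf : R f = combination C S p - duhamel C S f := rfl
    rw [hRf]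
    refine ⟨combination (-(z • S)) C p - duhamelDeriv z C S f,
      (hsol p).sub (h.isDeriv_duhamel f), ?_, ?_, ?_⟩
    · have := (hsol' p).sub (h.isDeriv_duhamelDeriv f)
      convert this using 1
      ext x e
      simp
      ring
    · rw [map_sub]
      exact (Submodule.Quotient.eq W₁).1 (congrArg Prod.fst hTp)
    · rw [map_sub]
      exact (Submodule.Quotient.eq W₂).1 (congrArg Prod.snd hTp)
  refine ⟨R, fun f => ?_, fun u => ?_⟩
  · obtain ⟨hd, e⟩ := hR f
    exact ⟨hd, by rw [e, add_sub_cancel_left]⟩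
  · obtain ⟨hd, e⟩ := hR (A u - z • (u : NetFun G))
    -- The difference `R (A u - z u) - u` satisfies the eigenvalue equation for `z`, hence vanishes.
    refine sub_eq_zero.1 (hinj _ ⟨A.domain.sub_mem hd u.2, ?_⟩)
    have := A.map_sub ⟨_, hd⟩ u
    rw [e] at this
    refine this.trans ?_
    rw [smul_sub]
    abel

end QGraph

end

/-! ### Incidence matrices of connected graphs -/

lemma Matrix.finrank_ker_add_finrank_range_transpose {m n K : Type*} [Field K] [Fintype m]
    [Fintype n] (M : Matrix m n K) :
    Module.finrank K (LinearMap.ker M.mulVecLin) +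
      Module.finrank K (LinearMap.range M.transpose.mulVecLin) = Fintype.card n := by
  have h := M.mulVecLin.finrank_range_add_finrank_ker
  have h' : Module.finrank K (LinearMap.range M.transpose.mulVecLin) =
    Module.finrank K (LinearMap.range M.mulVecLin) := M.rank_transpose
  rw [Module.finrank_fintype_fun_eq_card] at h
  omega

/-- Index formula: it reduces kernels on edge functions to kernels of the transpose on vertex
functions, which connectedness determines. -/
lemma Matrix.finrank_ker_add_card {m n K : Type*} [Field K] [Fintype m]
    [Fintype n] (M : Matrix m n K) :
    Module.finrank K (LinearMap.ker M.mulVecLin) + Fintype.card m =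
      Fintype.card n + Module.finrank K (LinearMap.ker M.transpose.mulVecLin) := by
  have h := M.transpose.mulVecLin.finrank_range_add_finrank_ker
  have h' := M.finrank_ker_add_finrank_range_transpose
  rw [Module.finrank_fintype_fun_eq_card] at h
  omega

lemma SimpleGraph.Connected.eq_of_forall_adj {V α : Type*} {G : SimpleGraph V} (hG : G.Connected)
    {f : V → α} (hf : ∀ v w, G.Adj v w → f v = f w) (v w : V) : f v = f w := by
  obtain ⟨p⟩ := hG v w
  induction p with
  | nil => rfl
  | cons h _ ih => exact (hf _ _ h).trans ih

/-- By connectedness `f` takes only the values `±f v₀`. If these differ, "`f v = f v₀`" is a proper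
two-colouring; `h2` excludes that they coincide without being zero. -/
lemma SimpleGraph.Connected.eq_zero_of_not_isBipartite {V R : Type*} [AddGroup R]
    {G : SimpleGraph V} (hG : G.Connected) (hb : ¬ G.IsBipartite) {f : V → R}
    (hf : ∀ v w, G.Adj v w → f w = -f v) (h2 : ∀ x : R, x = -x → x = 0) : f = 0 := by
  classical
  funext v₀
  have hpm : ∀ v, f v = f v₀ ∨ f v = -f v₀ := by
    intro v
    have := hG.eq_of_forall_adj (f := fun w => f w = f v₀ ∨ f w = -f v₀) (fun a b hab => by
      rw [hf a b hab, neg_eq_iff_eq_neg, neg_inj, or_comm]) v v₀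
    rw [this]
    exact Or.inl rfl
  by_contra h0
  refine hb ((SimpleGraph.Coloring.mk (α := Bool) (fun v => decide (f v = f v₀)) ?_).colorable)
  intro v w hvw heq
  rw [decide_eq_decide] at heq
  have h1 := hf v w hvw
  rcases hpm v with h | h
  · exact h0 (h2 _ (((heq.1 h).symm.trans h1).trans (by rw [h])))
  · have : f w = f v₀ := by rw [h1, h, neg_neg]
    exact h0 (h2 _ ((heq.2 this).symm.trans h))

namespace EdgeParam

variable {V : Type*} {G : SimpleGraph V} (P : EdgeParam G)

lemma adj (e : G.edgeSet) : G.Adj (P.tail e) (P.head e) := by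
  rw [← SimpleGraph.mem_edgeSet, ← P.endpoints]
  exact e.2

lemma tail_ne_head (e : G.edgeSet) : P.tail e ≠ P.head e := (P.adj e).ne

lemma mem_iff (v : V) (e : G.edgeSet) : v ∈ (e : Sym2 V) ↔ v = P.tail e ∨ v = P.head e := by
  rw [P.endpoints, Sym2.mem_iff]

/-- A symmetric relation that holds along all edges holds for all adjacent vertices. -/
lemma forall_adj {r : V → V → Prop} (hr : ∀ v w, r v w → r w v)
    (h : ∀ e, r (P.tail e) (P.head e)) (v w : V) (hvw : G.Adj v w) : r v w := by
  obtain ⟨e, he⟩ : ∃ e : G.edgeSet, (e : Sym2 V) = s(v, w) := ⟨⟨s(v, w), hvw⟩, rfl⟩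
  rw [P.endpoints] at he
  rcases Sym2.eq_iff.1 he with ⟨h1, h2⟩ | ⟨h1, h2⟩ <;> rw [← h1, ← h2]
  · exact h _
  · exact hr _ _ (h _)

variable [DecidableEq V] (K : Type*) [Field K]

/-- The signed incidence matrix. -/
def signedMatrix : Matrix V G.edgeSet K :=
  Matrix.of fun v e => (if P.head e = v then 1 else 0) - (if P.tail e = v then 1 else 0)

/-- The unsigned incidence matrix. -/
def unsignedMatrix : Matrix V G.edgeSet K :=
  Matrix.of fun v e => (if P.head e = v then 1 else 0) + (if P.tail e = v then 1 else 0)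

section

variable [Fintype V] {K}

lemma signedMatrix_transpose_mulVec (f : V → K) (e : G.edgeSet) :
    ((P.signedMatrix K).transpose.mulVec f) e = f (P.head e) - f (P.tail e) := by
  simp [Matrix.mulVec, dotProduct, signedMatrix, sub_mul, Finset.sum_sub_distrib]

lemma unsignedMatrix_transpose_mulVec (f : V → K) (e : G.edgeSet) :
    ((P.unsignedMatrix K).transpose.mulVec f) e = f (P.head e) + f (P.tail e) := by
  simp [Matrix.mulVec, dotProduct, unsignedMatrix, add_mul, Finset.sum_add_distrib]

variable [Fintype G.edgeSet]

variable (K) in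
/-- The dimension of the cycle space. -/
lemma finrank_ker_signedMatrix (hG : G.Connected) :
    Module.finrank K (LinearMap.ker (P.signedMatrix K).mulVecLin) + Fintype.card V =
      Fintype.card G.edgeSet + 1 := by
  rw [Matrix.finrank_ker_add_card]
  congr 1
  -- The kernel of the transpose consists of functions with equal values at both ends of every edge,
  -- that is, of the constants.
  have h1 : (1 : V → K) ∈ LinearMap.ker (P.signedMatrix K).transpose.mulVecLin := by
    rw [LinearMap.mem_ker]
    ext e
    rw [Matrix.mulVecLin_apply, signedMatrix_transpose_mulVec]
    simp
  obtain ⟨v₀⟩ := hG.nonempty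
  rw [finrank_eq_one_iff_of_nonzero' ⟨1, h1⟩]
  · rintro ⟨f, hf⟩
    refine ⟨f v₀, Subtype.ext (funext fun v => ?_)⟩
    have : ∀ v w, G.Adj v w → f v = f w := P.forall_adj (fun _ _ => Eq.symm) fun e => by
      have := congrFun hf e
      rw [Matrix.mulVecLin_apply, signedMatrix_transpose_mulVec] at this
      exact (sub_eq_zero.1 this).symm
    simpa using hG.eq_of_forall_adj this v₀ v
  · intro h
    simpa using congrFun (congrArg Subtype.val h) v₀

variable (K) in
-- The kernel of the transpose consists of functions changing sign along every edge; without a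
-- bipartition only zero does so.
lemma finrank_ker_unsignedMatrix (hG : G.Connected) (hb : ¬ G.IsBipartite) (h2 : (2 : K) ≠ 0) :
    Module.finrank K (LinearMap.ker (P.unsignedMatrix K).mulVecLin) + Fintype.card V =
      Fintype.card G.edgeSet := by
  rw [Matrix.finrank_ker_add_card, Nat.add_eq_left, Submodule.finrank_eq_zero, LinearMap.ker_eq_bot']
  intro f hf
  refine hG.eq_zero_of_not_isBipartite hb
    (P.forall_adj (fun v w h => by rw [h, neg_neg]) fun e => ?_) fun x hx => ?_
  · have := congrFun hf e
    rw [Matrix.mulVecLin_apply, unsignedMatrix_transpose_mulVec] at this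
    exact eq_neg_of_add_eq_zero_left this
  · have : 2 * x = 0 := by linear_combination hx
    exact (mul_eq_zero.1 this).resolve_left h2

end

end EdgeParam

/-! ### Circuits and the cycle space modulo two -/

/-- A circuit is a connected subgraph that is regular of degree two. -/
def SimpleGraph.Subgraph.IsCircuit {V : Type*} {G : SimpleGraph V} (H : G.Subgraph) : Prop :=
  H.Connected ∧ ∀ v ∈ H.verts, (H.neighborSet v).ncard = 2

namespace SimpleGraph.Subgraph.IsCircuit

variable {V : Type*} {G : SimpleGraph V} {H H' : G.Subgraph}

lemma exists_adj (h : H.IsCircuit) {v : V} (hv : v ∈ H.verts) : ∃ w, H.Adj v w := by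
  have : (H.neighborSet v).Nonempty := by
    apply Set.nonempty_of_ncard_ne_zero
    rw [h.2 v hv]
    exact two_ne_zero
  exact this

/-- Every vertex of a circuit lies on one of its edges, so its edges determine its vertices. -/
lemma le_of_edgeSet_subset (h : H.IsCircuit) (he : H.edgeSet ⊆ H'.edgeSet) : H ≤ H' := by
  have hadj : ∀ v w, H.Adj v w → H'.Adj v w := fun v w hvw =>
    Subgraph.mem_edgeSet.1 (he (Subgraph.mem_edgeSet.2 hvw))
  refine ⟨fun v hv => ?_, fun v w => hadj v w⟩
  obtain ⟨w, hw⟩ := h.exists_adj hv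
  exact (hadj v w hw).fst_mem

lemma eq_of_edgeSet_eq (h : H.IsCircuit) (h' : H'.IsCircuit) (he : H.edgeSet = H'.edgeSet) :
    H = H' :=
  le_antisymm (h.le_of_edgeSet_subset he.le) (h'.le_of_edgeSet_subset he.ge)

end SimpleGraph.Subgraph.IsCircuit

lemma SimpleGraph.Walk.IsCycle.isCircuit_toSubgraph {V : Type*} {G : SimpleGraph V} {u : V}
    {p : G.Walk u u} (hp : p.IsCycle) : p.toSubgraph.IsCircuit :=
  ⟨p.toSubgraph_connected, fun _ hv =>
    hp.ncard_neighborSet_toSubgraph_eq_two (p.mem_verts_toSubgraph.1 hv)⟩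

namespace EdgeParam

variable {V : Type*} {G : SimpleGraph V} (P : EdgeParam G)

/-- The indicator of the edges of a subgraph, modulo two. -/
noncomputable def edgeIndicator (H : G.Subgraph) : G.edgeSet → ZMod 2 :=
  Set.indicator {e | (e : Sym2 V) ∈ H.edgeSet} 1

lemma edgeIndicator_ne_zero {H : G.Subgraph} (h : H.IsCircuit) : edgeIndicator H ≠ 0 := by
  obtain ⟨v, hv⟩ := h.1.nonempty
  obtain ⟨w, hw⟩ := h.exists_adj hv
  intro h0
  have := congrFun h0 ⟨s(v, w), H.edgeSet_subset hw⟩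
  rw [edgeIndicator, Set.indicator_of_mem (by exact hw)] at this
  simp at this

lemma edgeSet_eq_of_edgeIndicator_eq {H H' : G.Subgraph} (h : edgeIndicator H = edgeIndicator H') :
    H.edgeSet = H'.edgeSet := by
  have := Set.indicator_one_inj (ZMod 2) h
  ext e
  constructor <;> intro he
  · exact (Set.ext_iff.1 this ⟨e, H.edgeSet_subset he⟩).1 he
  · exact (Set.ext_iff.1 this ⟨e, H'.edgeSet_subset he⟩).2 he

/-- Modulo two the signs disappear, and the entry at `v` is the degree of `v` in `H`: two on the
circuit, zero off it. -/
lemma edgeIndicator_mem_ker [DecidableEq V] [Fintype V] [Fintype G.edgeSet] {H : G.Subgraph}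
    (h : H.IsCircuit) : edgeIndicator H ∈ LinearMap.ker (P.signedMatrix (ZMod 2)).mulVecLin := by
  classical
  rw [LinearMap.mem_ker]
  ext v
  have h1 : ∀ e, P.signedMatrix (ZMod 2) v e * edgeIndicator H e =
      if v ∈ (e : Sym2 V) ∧ (e : Sym2 V) ∈ H.edgeSet then 1 else 0 := by
    intro e
    have := P.tail_ne_head e
    simp only [P.mem_iff]
    by_cases he : (e : Sym2 V) ∈ H.edgeSet
    · rw [edgeIndicator, Set.indicator_of_mem (by exact he)]
      simp only [signedMatrix, Matrix.of_apply, he, and_true, Pi.one_apply, mul_one]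
      by_cases h1 : P.head e = v <;> by_cases h2 : P.tail e = v
      · exact absurd (h2.trans h1.symm) this
      · simp [h1, h2, Ne.symm h2]
      · simp [h2, Ne.symm h1, h1]
      · simp [h1, h2, Ne.symm h1, Ne.symm h2]
    · rw [edgeIndicator, Set.indicator_of_notMem (by exact he)]
      simp [he]
  have h2 : (H.neighborSet v).ncard =
      (Finset.univ.filter fun e : G.edgeSet =>
        v ∈ (e : Sym2 V) ∧ (e : Sym2 V) ∈ H.edgeSet).card := by
    rw [← Set.ncard_coe_finset]
    refine Set.ncard_congr (fun w hw => ⟨s(v, w), H.edgeSet_subset hw⟩) ?_ ?_ ?_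
    · intro w hw
      simpa using hw
    · intro w w' _ _ hww
      exact Sym2.congr_right.1 (congrArg Subtype.val hww)
    · rintro ⟨e, he⟩ hv
      simp only [Finset.coe_filter, Finset.mem_univ, true_and, Set.mem_ofPred_eq] at hv
      obtain ⟨⟨w, rfl⟩, hw⟩ := hv
      exact ⟨w, hw, rfl⟩
  simp only [Matrix.mulVecLin_apply, Matrix.mulVec, dotProduct, h1, Pi.zero_apply]
  rw [Finset.sum_boole, ← h2]
  by_cases hv : v ∈ H.verts
  · rw [h.2 v hv]
    rfl
  · have : H.neighborSet v = ∅ := Set.eq_empty_of_forall_notMem fun w hw => hv hw.fst_mem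
    simp [this]

end EdgeParam

open EdgeParam in
-- If `#E = #V`, the cycle space over `ZMod 2` is a line with a single nonzero vector, which must be
-- the indicator of every circuit. Conversely, a circuit forces `#E ≥ #V`, and with more edges than
-- vertices one can delete an edge of a cycle and still find a cycle avoiding it.
lemma isUnicyclic_iff {V : Type*} {G : SimpleGraph V} [DecidableEq V] [Fintype V]
    [Fintype G.edgeSet] (P : EdgeParam G) (hG : G.Connected) :
    IsUnicyclic G ↔ Fintype.card G.edgeSet = Fintype.card V := by
  have hdim := P.finrank_ker_signedMatrix (ZMod 2) hG
  -- A connected graph without cycles is a tree and has only `#V - 1` edges.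
  have hcyc : ∀ G' : SimpleGraph V, G'.Connected → Fintype.card V ≤ Nat.card G'.edgeSet →
      ∃ (u : V) (p : G'.Walk u u), p.IsCycle := by
    intro G' h' hc
    by_contra! hno
    have : G'.IsTree := ⟨h', fun u p hp => hno u p hp⟩
    have := (SimpleGraph.isTree_iff_connected_and_card.1 this).2
    rw [Nat.card_eq_fintype_card (α := V)] at this
    omega
  rw [← Nat.card_eq_fintype_card (α := G.edgeSet)] at hdim ⊢
  constructor
  · rintro ⟨H, hH, huniq⟩
    have hH : H.IsCircuit := hH
    have hpos : 0 < Module.finrank (ZMod 2) (LinearMap.ker (P.signedMatrix (ZMod 2)).mulVecLin) :=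
      Module.finrank_pos_iff_exists_ne_zero.2 ⟨⟨_, P.edgeIndicator_mem_ker hH⟩, fun h0 =>
        edgeIndicator_ne_zero hH (congrArg Subtype.val h0)⟩
    by_contra hne
    have hlt : Fintype.card V < Nat.card G.edgeSet := by omega
    obtain ⟨u, p, hp⟩ := hcyc G hG hlt.le
    obtain ⟨e, he⟩ : ∃ e, e ∈ p.edges :=
      List.exists_mem_of_ne_nil _ fun h0 => hp.not_nil (by simpa using h0)
    have heG := p.edges_subset_edgeSet he
    induction e with | h x y =>
    have hnb : ¬ G.IsBridge s(x, y) := fun hb => hb.notMem_edges_of_isCycle hp he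
    have hG' := hG.connected_delete_edge_of_not_isBridge hnb
    have hcard : Nat.card (G.deleteEdges {s(x, y)}).edgeSet + 1 = Nat.card G.edgeSet := by
      rw [SimpleGraph.edgeSet_deleteEdges]
      exact Set.ncard_sdiff_singleton_add_one heG (Set.toFinite _)
    obtain ⟨u', p', hp'⟩ := hcyc _ hG' (by omega)
    have hp'' := hp'.mapLe (G.deleteEdges_le {s(x, y)})
    have heq : p.toSubgraph = (p'.mapLe (G.deleteEdges_le {s(x, y)})).toSubgraph :=
      (huniq _ hp.isCircuit_toSubgraph).trans (huniq _ hp''.isCircuit_toSubgraph).symm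
    rw [← SimpleGraph.Walk.mem_edges_toSubgraph, heq, SimpleGraph.Walk.mem_edges_toSubgraph,
      SimpleGraph.Walk.edges_mapLe_eq_edges] at he
    have := p'.edges_subset_edgeSet he
    simp at this
  · intro hcard
    obtain ⟨u, p, hp⟩ := hcyc G hG hcard.ge
    refine ⟨p.toSubgraph, hp.isCircuit_toSubgraph, fun H' (hH' : H'.IsCircuit) => ?_⟩
    have hH := hp.isCircuit_toSubgraph
    refine hH'.eq_of_edgeSet_eq hH (edgeSet_eq_of_edgeIndicator_eq ?_)
    have h1 : Module.finrank (ZMod 2) (LinearMap.ker (P.signedMatrix (ZMod 2)).mulVecLin) = 1 := by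
      omega
    obtain ⟨c, hc⟩ := (finrank_eq_one_iff_of_nonzero' ⟨_, P.edgeIndicator_mem_ker hH⟩ (fun h0 =>
      edgeIndicator_ne_zero hH (congrArg Subtype.val h0))).1 h1 ⟨_, P.edgeIndicator_mem_ker hH'⟩
    have hc' : c • edgeIndicator p.toSubgraph = edgeIndicator H' := congrArg Subtype.val hc
    have hc0 : c ≠ 0 := by
      rintro rfl
      exact edgeIndicator_ne_zero hH' (by rw [← hc', zero_smul])
    have hone : ∀ c : ZMod 2, c ≠ 0 → c = 1 := by decide
    rw [← hc', hone c hc0, one_smul]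

/-! ### Vertex conditions as subspaces of functions on the ends -/

noncomputable section

namespace QGraph

open Module

variable {V : Type*} {G : SimpleGraph V}

section

variable [DecidableEq V]

/-- The matrix assigning to each vertex the ends of edges that lie at it. -/
def endMatrix (P : EdgeParam G) : Matrix V (EdgeEnd G) ℂ :=
  Matrix.of fun v i => if i.vertex P = v then 1 else 0

lemma pos_vertex (P : EdgeParam G) (i : EdgeEnd G) : pos P (i.vertex P) i.1 = i.param := by
  obtain ⟨e, b⟩ := i
  cases b
  · simp [pos, EdgeEnd.vertex, EdgeEnd.param, P.tail_ne_head e]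
  · simp [pos, EdgeEnd.vertex, EdgeEnd.param]

lemma incidence_vertex (P : EdgeParam G) (i : EdgeEnd G) :
    incidence P (i.vertex P) i.1 = i.sign := by
  obtain ⟨e, b⟩ := i
  cases b
  · simp [incidence, EdgeEnd.vertex, EdgeEnd.sign, P.tail_ne_head e]
  · simp [incidence, EdgeEnd.vertex, EdgeEnd.sign]

lemma incidence_eq_zero (P : EdgeParam G) {v : V} {e : G.edgeSet} (h : v ∉ (e : Sym2 V)) :
    incidence P v e = 0 := by
  rw [P.mem_iff, not_or] at h
  simp [incidence, h.1, h.2]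

variable [Fintype G.edgeSet]

/-- The functions on the ends whose sum vanishes at every vertex. -/
def balancedEnds (P : EdgeParam G) : Submodule ℂ (EdgeEnd G → ℂ) :=
  LinearMap.ker (endMatrix P).mulVecLin

lemma mem_balancedEnds (P : EdgeParam G) (y : EdgeEnd G → ℂ) : y ∈ balancedEnds P ↔
    ∀ v, ∑ e : G.edgeSet, ((if P.head e = v then 1 else 0) * y (e, true) +
      (if P.tail e = v then 1 else 0) * y (e, false)) = 0 := by
  rw [balancedEnds, LinearMap.mem_ker, funext_iff]
  refine forall_congr' fun v => ?_
  simp [Matrix.mulVec, dotProduct, endMatrix, Fintype.sum_prod_type, EdgeEnd.vertex]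

variable [Fintype V]

/-- The functions on the ends that depend on the vertex only. -/
def constantEnds (P : EdgeParam G) : Submodule ℂ (EdgeEnd G → ℂ) :=
  LinearMap.range (endMatrix P).transpose.mulVecLin

omit [Fintype G.edgeSet] in
lemma mem_constantEnds (P : EdgeParam G) (y : EdgeEnd G → ℂ) : y ∈ constantEnds P ↔
    ∃ f : V → ℂ, ∀ i, y i = f (i.vertex P) := by
  rw [constantEnds, LinearMap.mem_range]
  refine exists_congr fun f => ?_
  rw [funext_iff]
  refine forall_congr' fun i => ?_
  rw [Matrix.mulVecLin_apply]
  simp only [Matrix.mulVec, dotProduct, endMatrix, Matrix.transpose_apply, Matrix.of_apply,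
    ite_mul, one_mul, zero_mul, Finset.sum_ite_eq, Finset.mem_univ, if_true]
  exact eq_comm

lemma finrank_balancedEnds_add_finrank_constantEnds (P : EdgeParam G) :
    finrank ℂ (balancedEnds P) + finrank ℂ (constantEnds P) = Fintype.card (EdgeEnd G) :=
  (endMatrix P).finrank_ker_add_finrank_range_transpose

/-- Balanced functions annihilate those depending on the vertex only: group the ends by vertex. This
replaces integration by parts in the computation of the kernels. -/
lemma sum_mul_eq_zero_of_mem_balancedEnds {P : EdgeParam G} {y : EdgeEnd G → ℂ}
    (hy : y ∈ balancedEnds P) (f : V → ℂ) :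
    ∑ e : G.edgeSet, (f (P.head e) * y (e, true) + f (P.tail e) * y (e, false)) = 0 := by
  have h : ∑ v, f v * ∑ e : G.edgeSet, ((if P.head e = v then 1 else 0) * y (e, true) +
      (if P.tail e = v then 1 else 0) * y (e, false)) = 0 :=
    Finset.sum_eq_zero fun v _ => by rw [(mem_balancedEnds P y).1 hy v, mul_zero]
  simp_rw [Finset.mul_sum] at h
  rw [Finset.sum_comm] at h
  rw [← h]
  refine Finset.sum_congr rfl fun e _ => ?_
  simp [mul_add, Finset.sum_add_distrib]

omit [Fintype G.edgeSet] in
lemma mul_mem_constantEnds {P : EdgeParam G} {y w : EdgeEnd G → ℂ} (hy : y ∈ constantEnds P)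
    (f : V → ℂ) (hw : ∀ i, w i = f (i.vertex P) * y i) : w ∈ constantEnds P := by
  rw [mem_constantEnds] at hy ⊢
  obtain ⟨g, hg⟩ := hy
  exact ⟨f * g, fun i => by rw [hw, hg]; rfl⟩

omit [Fintype V] in
lemma mul_mem_balancedEnds {P : EdgeParam G} {y w : EdgeEnd G → ℂ} (hy : y ∈ balancedEnds P)
    (f : V → ℂ) (hw : ∀ i, w i = f (i.vertex P) * y i) : w ∈ balancedEnds P := by
  rw [mem_balancedEnds] at hy ⊢
  intro v
  have h := congrArg (f v * ·) (hy v)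
  simp only [mul_zero, Finset.mul_sum] at h
  refine (Finset.sum_congr rfl fun e _ => ?_).trans h
  rw [hw, hw]
  simp only [EdgeEnd.vertex, if_true, Bool.false_eq_true, if_false]
  split_ifs with h1 h2 h2 <;> try simp only [h1, h2]
  all_goals ring

/-- A family of numbers attached to the ends does not depend on the edge. -/
lemma forall_incident_eq_iff (P : EdgeParam G) (φ : V → G.edgeSet → ℂ) :
    (∀ (v : V) (e e' : G.edgeSet), v ∈ (e : Sym2 V) → v ∈ (e' : Sym2 V) → φ v e = φ v e') ↔
      (fun i : EdgeEnd G => φ (i.vertex P) i.1) ∈ constantEnds P := by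
  classical
  rw [mem_constantEnds]
  have hmem : ∀ i : EdgeEnd G, i.vertex P ∈ (i.1 : Sym2 V) := by
    rintro ⟨e, b⟩
    rw [P.mem_iff]
    cases b
    · exact Or.inl rfl
    · exact Or.inr rfl
  constructor
  · intro h
    refine ⟨fun v => if hv : ∃ e : G.edgeSet, v ∈ (e : Sym2 V) then φ v hv.choose else 0,
      fun i => ?_⟩
    have hv : ∃ e : G.edgeSet, i.vertex P ∈ (e : Sym2 V) := ⟨_, hmem i⟩
    simp only [dif_pos hv]
    exact h _ _ _ (hmem i) hv.choose_spec
  · rintro ⟨f, hf⟩ v e e' he he'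
    have key : ∀ e : G.edgeSet, v ∈ (e : Sym2 V) → φ v e = f v := by
      intro e he
      rcases (P.mem_iff v e).1 he with rfl | rfl
      · exact hf (e, false)
      · exact hf (e, true)
    rw [key e he, key e' he']

omit [Fintype V] in
lemma forall_sum_eq_zero_iff (P : EdgeParam G) (φ : V → G.edgeSet → ℂ)
    (hφ : ∀ (v : V) (e : G.edgeSet), v ∉ (e : Sym2 V) → φ v e = 0) :
    (∀ v, ∑ e, φ v e = 0) ↔
      (fun i : EdgeEnd G => φ (i.vertex P) i.1) ∈ balancedEnds P := by
  rw [mem_balancedEnds]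
  refine forall_congr' fun v => ?_
  suffices h : ∀ e, φ v e = (if P.head e = v then 1 else 0) * φ (P.head e) e +
      (if P.tail e = v then 1 else 0) * φ (P.tail e) e by
    rw [Finset.sum_congr rfl fun e _ => h e]
    rfl
  intro e
  have hne := P.tail_ne_head e
  by_cases h1 : P.head e = v
  · subst h1
    simp [hne]
  · by_cases h2 : P.tail e = v
    · subst h2
      simp [hne.symm]
    · rw [hφ v e (by rw [P.mem_iff]; rintro (h | h); exacts [h2 h.symm, h1 h.symm])]
      simp [h1, h2]

omit [Fintype G.edgeSet] [Fintype V] in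
lemma IsDeriv.incidence_mul_edgeDeriv {u u' : NetFun G} (hu : IsDeriv u u') (P : EdgeParam G)
    (i : EdgeEnd G) : incidence P (i.vertex P) i.1 *
      edgeDeriv u i.1 (pos P (i.vertex P) i.1) = signedTrace G u' i := by
  rw [incidence_vertex, pos_vertex, hu.edgeDeriv_eq _ i.param.2, comp_coe, signedTrace_apply]

/-- Compared with `kcCondition_iff`, the two subspaces trade places; this duality drives the whole
comparison. -/
lemma ckCondition_iff (P : EdgeParam G) {u u' : NetFun G} (hu : IsDeriv u u') :
    CKCondition P u ↔ trace G u ∈ constantEnds P ∧ signedTrace G u' ∈ balancedEnds P := by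
  rw [CKCondition, forall_incident_eq_iff P (fun v e => u (pos P v e) e),
    forall_sum_eq_zero_iff P (fun v e => incidence P v e * edgeDeriv u e (pos P v e))
      fun v e h => by rw [incidence_eq_zero P h, zero_mul]]
  simp_rw [hu.incidence_mul_edgeDeriv, pos_vertex]
  rfl

lemma kcCondition_iff (P : EdgeParam G) {u u' : NetFun G} (hu : IsDeriv u u') :
    KCCondition P u ↔ trace G u ∈ balancedEnds P ∧ signedTrace G u' ∈ constantEnds P := by
  rw [KCCondition, forall_incident_eq_iff P
      (fun v e => incidence P v e * edgeDeriv u e (pos P v e)),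
    forall_sum_eq_zero_iff P (fun v e => incidence P v e ^ 2 * u (pos P v e) e)
      fun v e h => by rw [incidence_eq_zero P h]; ring]
  have hs : ∀ i : EdgeEnd G, i.sign ^ 2 = 1 := by
    rintro ⟨e, b⟩
    cases b <;> simp [EdgeEnd.sign]
  simp_rw [hu.incidence_mul_edgeDeriv, pos_vertex, incidence_vertex, hs, one_mul]
  rfl

lemma neg_laplacianCK_apply_eq_iff (P : EdgeParam G) (u w : NetFun G) :
    (∃ h : u ∈ (-laplacianCK P).domain, (-laplacianCK P) ⟨u, h⟩ = w) ↔
      ∃ u', IsDeriv u u' ∧ IsDeriv u' (-w) ∧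
        trace G u ∈ constantEnds P ∧ signedTrace G u' ∈ balancedEnds P := by
  refine (laplacian_domRestrict_iff (domainCK P) (fun u hu => hu.1) u w).trans ?_
  constructor
  · rintro ⟨hu, u', h1, h2⟩
    exact ⟨u', h1, h2, (ckCondition_iff P h1).1 hu.2⟩
  · rintro ⟨u', h1, h2, h3⟩
    exact ⟨⟨isC2_iff.2 ⟨_, _, h1, h2⟩, (ckCondition_iff P h1).2 h3⟩, u', h1, h2⟩

lemma neg_laplacianKC_apply_eq_iff (P : EdgeParam G) (u w : NetFun G) :
    (∃ h : u ∈ (-laplacianKC P).domain, (-laplacianKC P) ⟨u, h⟩ = w) ↔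
      ∃ u', IsDeriv u u' ∧ IsDeriv u' (-w) ∧
        trace G u ∈ balancedEnds P ∧ signedTrace G u' ∈ constantEnds P := by
  refine (laplacian_domRestrict_iff (domainKC P) (fun u hu => hu.1) u w).trans ?_
  constructor
  · rintro ⟨hu, u', h1, h2⟩
    exact ⟨u', h1, h2, (kcCondition_iff P h1).1 hu.2⟩
  · rintro ⟨u', h1, h2, h3⟩
    exact ⟨⟨isC2_iff.2 ⟨_, _, h1, h2⟩, (kcCondition_iff P h1).2 h3⟩, u', h1, h2⟩

lemma mem_eigenspaceCK (P : EdgeParam G) (z : ℂ) (u : NetFun G) :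
    u ∈ UnboundedOp.eigenspace (-laplacianCK P) z ↔
      ∃ u', IsDeriv u u' ∧ IsDeriv u' (-(z • u)) ∧
        trace G u ∈ constantEnds P ∧ signedTrace G u' ∈ balancedEnds P :=
  (UnboundedOp.mem_eigenspace _ _ _).trans (neg_laplacianCK_apply_eq_iff P u _)

lemma mem_eigenspaceKC (P : EdgeParam G) (z : ℂ) (u : NetFun G) :
    u ∈ UnboundedOp.eigenspace (-laplacianKC P) z ↔
      ∃ u', IsDeriv u u' ∧ IsDeriv u' (-(z • u)) ∧
        trace G u ∈ balancedEnds P ∧ signedTrace G u' ∈ constantEnds P :=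
  (UnboundedOp.mem_eigenspace _ _ _).trans (neg_laplacianKC_apply_eq_iff P u _)

lemma mem_resolventSetCK_iff (P : EdgeParam G) (z : ℂ) :
    z ∈ UnboundedOp.resolventSet (-laplacianCK P) ↔
      UnboundedOp.eigenspace (-laplacianCK P) z = ⊥ :=
  ⟨UnboundedOp.eigenspace_eq_bot_of_mem_resolventSet _,
    mem_resolventSet_of_eigenspace_eq_bot _ (constantEnds P) (balancedEnds P)
      (by rw [add_comm]; exact finrank_balancedEnds_add_finrank_constantEnds P)
      (neg_laplacianCK_apply_eq_iff P)⟩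

lemma mem_resolventSetKC_iff (P : EdgeParam G) (z : ℂ) :
    z ∈ UnboundedOp.resolventSet (-laplacianKC P) ↔
      UnboundedOp.eigenspace (-laplacianKC P) z = ⊥ :=
  ⟨UnboundedOp.eigenspace_eq_bot_of_mem_resolventSet _,
    mem_resolventSet_of_eigenspace_eq_bot _ (balancedEnds P) (constantEnds P)
      (finrank_balancedEnds_add_finrank_constantEnds P) (neg_laplacianKC_apply_eq_iff P)⟩

/-- As both spectra consist of eigenvalues, it suffices to compare the multiplicities. -/
lemma sameSpectrum_iff (P : EdgeParam G) :
    UnboundedOp.SameSpectrum (-laplacianCK P) (-laplacianKC P) ↔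
      ∀ z, Module.rank ℂ (UnboundedOp.eigenspace (-laplacianCK P) z) =
        Module.rank ℂ (UnboundedOp.eigenspace (-laplacianKC P) z) := by
  refine ⟨fun h => h.2, fun h => ⟨?_, h⟩⟩
  rw [UnboundedOp.spectrum, UnboundedOp.spectrum, compl_inj_iff]
  ext z
  rw [mem_resolventSetCK_iff, mem_resolventSetKC_iff, ← Submodule.rank_eq_zero,
    ← Submodule.rank_eq_zero, h]

end

end QGraph

end

/-! ### Comparison of dimensions of eigenspaces -/

noncomputable section

lemma SimpleGraph.IsBipartite.exists_sign {V : Type*} {G : SimpleGraph V} (hb : G.IsBipartite) :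
    ∃ σ : V → ℂ, (∀ v, σ v * σ v = 1) ∧ ∀ v w, G.Adj v w → σ v = -σ w := by
  obtain ⟨c⟩ := hb
  refine ⟨fun v => if c v = 0 then 1 else -1, fun v => ?_, fun v w hvw => ?_⟩
  · dsimp only
    split_ifs <;> norm_num
  · have := c.valid hvw
    dsimp only
    split_ifs with h1 h2 h2
    · exact absurd (h1.trans h2.symm) this
    · norm_num
    · norm_num
    · omega

namespace QGraph

open Module

universe u

variable {V : Type u} {G : SimpleGraph V}

lemma trace_tail (u : NetFun G) (e : G.edgeSet) : trace G u (e, false) = u 0 e := rfl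

lemma trace_head (u : NetFun G) (e : G.edgeSet) : trace G u (e, true) = u 1 e := rfl

lemma signedTrace_tail (u : NetFun G) (e : G.edgeSet) : signedTrace G u (e, false) = -u 0 e := by
  simp [signedTrace_apply, EdgeEnd.sign, EdgeEnd.param]

lemma signedTrace_head (u : NetFun G) (e : G.edgeSet) : signedTrace G u (e, true) = u 1 e := by
  simp [signedTrace_apply, EdgeEnd.sign, EdgeEnd.param]

lemma vertex_tail (P : EdgeParam G) (e : G.edgeSet) :
    EdgeEnd.vertex P (e, false) = P.tail e := rfl

lemma vertex_head (P : EdgeParam G) (e : G.edgeSet) :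
    EdgeEnd.vertex P (e, true) = P.head e := rfl

/-- A linear map applied to derivatives compares dimensions. -/
lemma rank_le_of_isDeriv {M : Type u} [AddCommGroup M] [Module ℂ M] {E : Submodule ℂ (NetFun G)}
    {F : Submodule ℂ M} (L : NetFun G →ₗ[ℂ] M)
    (h : ∀ u ∈ E, ∃ w, IsDeriv u w ∧ L w ∈ F ∧ (L w = 0 → u = 0)) :
    Module.rank ℂ E ≤ Module.rank ℂ F := by
  choose w hw hF h0 using h
  -- The chosen `w` depends linearly on `u` because derivatives are unique.
  let D : E →ₗ[ℂ] F :=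
    { toFun := fun u => ⟨L (w u u.2), hF u u.2⟩
      map_add' := fun u v => Subtype.ext 
        ((congrArg L ((hw _ (u + v).2).unique ((hw u u.2).add (hw v v.2)))).trans (map_add L _ _))
      map_smul' := fun c u => Subtype.ext 
        ((congrArg L ((hw _ (c • u).2).unique ((hw u u.2).smul c))).trans (map_smul L _ _)) }
  refine D.rank_le_of_injective fun u v huv => Subtype.ext (sub_eq_zero.1 ?_)
  have huv : L (w u u.2) = L (w v v.2) := congrArg Subtype.val huv
  have hsub : (u : NetFun G) - v ∈ E := E.sub_mem u.2 v.2
  apply h0 _ hsub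
  rw [(hw _ hsub).unique ((hw u u.2).sub (hw v v.2)), map_sub, huv, sub_self]

lemma rank_le_of_map {M N : Type u} [AddCommGroup M] [Module ℂ M] [AddCommGroup N] [Module ℂ N]
    {E : Submodule ℂ M} {F : Submodule ℂ N} (L : M →ₗ[ℂ] N) (h : ∀ x ∈ E, L x ∈ F)
    (h0 : ∀ x ∈ E, L x = 0 → x = 0) : Module.rank ℂ E ≤ Module.rank ℂ F := by
  refine (L.restrict h).rank_le_of_injective ((injective_iff_map_eq_zero _).2 fun u hu => ?_)
  exact Subtype.ext (h0 u u.2 (congrArg Subtype.val hu))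

lemma mem_ker_signedMatrix_iff [DecidableEq V] [Fintype G.edgeSet] (P : EdgeParam G)
    (β : G.edgeSet → ℂ) : β ∈ LinearMap.ker (P.signedMatrix ℂ).mulVecLin ↔
      (fun i : EdgeEnd G => i.sign * β i.1) ∈ balancedEnds P := by
  rw [mem_balancedEnds, LinearMap.mem_ker, funext_iff]
  refine forall_congr' fun v => ?_
  simp only [Matrix.mulVecLin_apply, Matrix.mulVec, dotProduct, EdgeParam.signedMatrix,
    Matrix.of_apply, sub_mul, EdgeEnd.sign, if_true, Bool.false_eq_true, if_false, one_mul,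
    neg_one_mul, mul_neg, ← sub_eq_add_neg, Pi.zero_apply]

lemma mem_ker_unsignedMatrix_iff [DecidableEq V] [Fintype G.edgeSet] (P : EdgeParam G)
    (β : G.edgeSet → ℂ) : β ∈ LinearMap.ker (P.unsignedMatrix ℂ).mulVecLin ↔
      (fun i : EdgeEnd G => β i.1) ∈ balancedEnds P := by
  rw [mem_balancedEnds, LinearMap.mem_ker, funext_iff]
  refine forall_congr' fun v => ?_
  simp only [Matrix.mulVecLin_apply, Matrix.mulVec, dotProduct, EdgeParam.unsignedMatrix,
    Matrix.of_apply, add_mul, Pi.zero_apply]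

lemma eq_affine {u u' : NetFun G} (hu : IsDeriv u u') (hu' : IsDeriv u' (-((0 : ℂ) • u))) :
    u = ContinuousMap.const unitInterval (u 0) + idFun G * ContinuousMap.const unitInterval (u' 0)
      ∧ u' = ContinuousMap.const unitInterval (u' 0) := by
  refine ⟨?_, IsDeriv.eq_const ?_⟩
  · conv_lhs => rw [isFundamental_zero.eq hu hu', one_mul]
  · have : -((0 : ℂ) • u) = 0 := by
      ext x e
      simp
    rwa [this] at hu'

lemma IsDeriv.const_of_eq_zero (b : G.edgeSet → ℂ) :
    IsDeriv (0 : NetFun G) (-((0 : ℂ) • ContinuousMap.const unitInterval b)) := by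
  have : -((0 : ℂ) • ContinuousMap.const unitInterval b) = 0 := by
    ext x e
    simp
  rw [this]
  exact isDeriv_const 0

/-! ### Bipartite graphs -/

section

variable (P : EdgeParam G) {σ : V → ℂ} (h1 : ∀ v, σ v * σ v = 1)
  (hσ : ∀ v w, G.Adj v w → σ v = -σ w)

include hσ

/-- At the tail, `σ` at the head is minus `σ` at the tail, which is exactly the sign of that end. So
the sign of the end is traded for a factor depending on the vertex. -/
lemma trace_sign_mul (g : NetFun G) (i : EdgeEnd G) :
    trace G (ContinuousMap.const unitInterval (fun e => σ (P.head e)) * g) i =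
      σ (i.vertex P) * signedTrace G g i := by
  obtain ⟨e, b⟩ := i
  cases b
  · rw [trace_tail, signedTrace_tail, vertex_tail, hσ _ _ (P.adj e)]
    simp
  · rw [trace_head, signedTrace_head, vertex_head]
    simp

lemma signedTrace_sign_mul (g : NetFun G) (i : EdgeEnd G) :
    signedTrace G (ContinuousMap.const unitInterval (fun e => σ (P.head e)) * g) i =
      σ (i.vertex P) * trace G g i := by
  obtain ⟨e, b⟩ := i
  cases b
  · rw [trace_tail, signedTrace_tail, vertex_tail, hσ _ _ (P.adj e)]
    simp
  · rw [trace_head, signedTrace_head, vertex_head]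
    simp

include h1

omit hσ in
lemma sign_mul_eq_zero {u u' : NetFun G} {z : ℂ} (hz : z ≠ 0) (hu' : IsDeriv u' (-(z • u)))
    (h : ContinuousMap.const unitInterval (fun e => σ (P.head e)) * u' = 0) : u = 0 := by
  have h0 : u' = 0 := by
    ext x e
    have := congrFun (DFunLike.congr_fun h x) e
    simp only [ContinuousMap.mul_apply, ContinuousMap.const_apply, Pi.mul_apply,
      ContinuousMap.zero_apply, Pi.zero_apply, mul_eq_zero] at this ⊢
    refine this.resolve_left fun h' => ?_
    have := h1 (P.head e)
    rw [h', mul_zero] at this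
    exact zero_ne_one this
  rw [h0] at hu'
  have := hu'.unique (isDeriv_const 0)
  ext x e
  have := congrFun (DFunLike.congr_fun this x) e
  simpa [hz] using this

variable [DecidableEq V] [Fintype V] [Fintype G.edgeSet]

/-- On bipartite graphs, differentiation interchanges both types of eigenfunctions for nonzero
eigenvalues. -/
lemma rank_eigenspace_eq_of_ne_zero {z : ℂ} (hz : z ≠ 0) :
    Module.rank ℂ (UnboundedOp.eigenspace (-laplacianCK P) z) =
      Module.rank ℂ (UnboundedOp.eigenspace (-laplacianKC P) z) := by
  -- With `w = σ u'` one has `w' = σ u'' = -z σ u`, hence `w'' = -z w`.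
  have hd : ∀ u u' : NetFun G, IsDeriv u u' →
      IsDeriv (ContinuousMap.const unitInterval (fun e => σ (P.head e)) * -(z • u))
      (-(z • (ContinuousMap.const unitInterval (fun e => σ (P.head e)) * u'))) := by
    intro u u' hu
    have := (hu.smul z).neg.const_mul (fun e => σ (P.head e))
    convert this using 1
    ext x e
    simp
    ring
  have hs : ∀ (u : NetFun G) (i : EdgeEnd G), signedTrace G
      (ContinuousMap.const unitInterval (fun e => σ (P.head e)) * -(z • u)) i =
      (-(z • σ)) (i.vertex P) * trace G u i := by
    intro u i
    rw [signedTrace_sign_mul P hσ, map_neg, map_smul]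
    simp
    ring
  apply le_antisymm
  · refine rank_le_of_isDeriv
      (LinearMap.mulLeft ℂ (ContinuousMap.const unitInterval fun e => σ (P.head e)))
      fun u hu => ?_
    obtain ⟨u', hu, hu', ht, hst⟩ := (mem_eigenspaceCK P z u).1 hu
    refine ⟨u', hu, (mem_eigenspaceKC P z _).2 ⟨_, hu'.const_mul _, hd u u' hu, ?_, ?_⟩,
      sign_mul_eq_zero P h1 hz hu'⟩
    · exact mul_mem_balancedEnds hst σ (trace_sign_mul P hσ u')
    · exact mul_mem_constantEnds ht (-(z • σ)) (hs u)
  · refine rank_le_of_isDeriv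
      (LinearMap.mulLeft ℂ (ContinuousMap.const unitInterval fun e => σ (P.head e)))
      fun u hu => ?_
    obtain ⟨u', hu, hu', ht, hst⟩ := (mem_eigenspaceKC P z u).1 hu
    refine ⟨u', hu, (mem_eigenspaceCK P z _).2 ⟨_, hu'.const_mul _, hd u u' hu, ?_, ?_⟩,
      sign_mul_eq_zero P h1 hz hu'⟩
    · exact mul_mem_constantEnds hst σ (trace_sign_mul P hσ u')
    · exact mul_mem_balancedEnds ht (-(z • σ)) (hs u)

omit [Fintype V] h1 in
lemma trace_const_mem_balancedEnds_iff (h1 : ∀ v, σ v * σ v = 1) (b : G.edgeSet → ℂ) :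
    trace G (ContinuousMap.const unitInterval b) ∈ balancedEnds P ↔
      (fun e => σ (P.head e) * b e) ∈ LinearMap.ker (P.signedMatrix ℂ).mulVecLin := by
  rw [mem_ker_signedMatrix_iff]
  have h : ∀ i : EdgeEnd G, i.sign * (σ (P.head i.1) * b i.1) =
      σ (i.vertex P) * trace G (ContinuousMap.const unitInterval b) i := by
    rintro ⟨e, _ | _⟩
    · rw [vertex_tail, hσ _ _ (P.adj e), trace_tail]
      simp [EdgeEnd.sign]
    · rw [vertex_head, trace_head]
      simp [EdgeEnd.sign]
  refine ⟨fun hb => mul_mem_balancedEnds hb σ h, fun hb => mul_mem_balancedEnds hb σ fun i => ?_⟩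
  rw [h, ← mul_assoc, h1, one_mul]

/-- The kernel of the Laplacian with the KC-condition on a bipartite graph. -/
lemma mem_eigenspaceKC_zero_iff (hG : G.Connected) (u : NetFun G) :
    u ∈ UnboundedOp.eigenspace (-laplacianKC P) 0 ↔
      u = ContinuousMap.const unitInterval (u 0) ∧
        (fun e => σ (P.head e) * u 0 e) ∈ LinearMap.ker (P.signedMatrix ℂ).mulVecLin := by
  rw [mem_eigenspaceKC, ← trace_const_mem_balancedEnds_iff P hσ h1]
  constructor
  · rintro ⟨u', hu, hu', ht, hst⟩
    obtain ⟨e1, e2⟩ := eq_affine hu hu'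
    obtain ⟨c, hc⟩ := (mem_constantEnds P _).1 hst
    -- The slope of an affine function is constant on its edge, so its outer derivatives `c` at the
    -- two ends are opposite; hence `σ c` is the same at all vertices.
    have hconst := hG.eq_of_forall_adj (f := fun v => σ v * c v)
      (P.forall_adj (fun _ _ => Eq.symm) fun e => by
        rw [← vertex_tail, ← vertex_head, ← hc, ← hc, vertex_tail, vertex_head, signedTrace_tail,
          signedTrace_head, hσ _ _ (P.adj e), e2]
        simp)
    have ha : ∀ e, σ (P.head e) * u' 0 e = σ (P.head e) * c (P.head e) := fun e => by
      rw [← vertex_head, ← hc, signedTrace_head, e2]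
      rfl
    have h0 : u' 0 = 0 := by
      funext e₀
      -- Pairing the balanced trace with `σ`, each edge contributes `σ` times its slope, the same
      -- number `κ` for all edges. Thus `N κ = 0` and all slopes vanish.
      have hsum := sum_mul_eq_zero_of_mem_balancedEnds ht σ
      have hterm : ∀ e : G.edgeSet, σ (P.head e) * trace G u (e, true) +
          σ (P.tail e) * trace G u (e, false) = σ (P.head e₀) * c (P.head e₀) := fun e => by
        rw [hconst _ (P.head e), ← ha, trace_head, trace_tail, hσ _ _ (P.adj e)]
        have : u 1 e = u 0 e + u' 0 e := by
          conv_lhs => rw [e1]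
          simp [idFun]
        rw [this]
        ring
      simp only [hterm, Finset.sum_const, Finset.card_univ, nsmul_eq_mul, mul_eq_zero,
        Nat.cast_eq_zero] at hsum
      have : Nonempty G.edgeSet := ⟨e₀⟩
      have h2 := hsum.resolve_left Fintype.card_ne_zero
      have h3 := ha e₀
      rw [mul_eq_zero.2 h2] at h3
      refine (mul_eq_zero.1 h3).resolve_left fun h' => ?_
      have := h1 (P.head e₀)
      rw [h', mul_zero] at this
      exact zero_ne_one this
    have e3 : u = ContinuousMap.const unitInterval (u 0) := by
      conv_lhs => rw [e1, h0]
      ext x e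
      simp
    refine ⟨e3, ?_⟩
    rwa [e3] at ht
  · rintro ⟨hu, hb⟩
    rw [hu]
    refine ⟨0, isDeriv_const _, IsDeriv.const_of_eq_zero _, hb, ?_⟩
    rw [map_zero]
    exact zero_mem _

lemma rank_eigenspaceKC_zero (hG : G.Connected) :
    Module.rank ℂ (UnboundedOp.eigenspace (-laplacianKC P) 0) =
      Module.rank ℂ (LinearMap.ker (P.signedMatrix ℂ).mulVecLin) := by
  have hz : ∀ e, σ (P.head e) ≠ 0 := fun e h' => by
    have := h1 (P.head e)
    rw [h', mul_zero] at this
    exact zero_ne_one this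
  apply le_antisymm
  · refine rank_le_of_map
      (LinearMap.mulLeft ℂ (fun e => σ (P.head e)) ∘ₗ
        (ContinuousMap.evalCLM ℂ (0 : unitInterval)).toLinearMap)
      (fun u hu => ((mem_eigenspaceKC_zero_iff P h1 hσ hG u).1 hu).2) fun u hu h => ?_
    rw [((mem_eigenspaceKC_zero_iff P h1 hσ hG u).1 hu).1]
    ext x e
    have : σ (P.head e) * u 0 e = 0 := congrFun h e
    exact (mul_eq_zero.1 this).resolve_left (hz e)
  · let L : (G.edgeSet → ℂ) →ₗ[ℂ] NetFun G :=
      { toFun := fun β => ContinuousMap.const unitInterval fun e => σ (P.head e) * β e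
        map_add' := fun β γ => by
          ext x e
          simp [mul_add]
        map_smul' := fun c β => by
          ext x e
          simp [mul_left_comm] }
    refine rank_le_of_map L (fun β hβ => (mem_eigenspaceKC_zero_iff P h1 hσ hG _).2 ⟨rfl, ?_⟩)
      fun β _ h => ?_
    · convert hβ using 2 with e
      change σ (P.head e) * (σ (P.head e) * β e) = β e
      rw [← mul_assoc, h1, one_mul]
    · funext e
      have : σ (P.head e) * β e = 0 := congrFun (DFunLike.congr_fun h 0) e
      exact (mul_eq_zero.1 this).resolve_left (hz e)

end

/-! ### The CK-kernel and the eigenvalue `π²` -/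

lemma cosFun_pi_one : cosFun G Real.pi 1 = -1 := by
  ext e
  simp [cosFun]

lemma sinFun_pi_one : sinFun G Real.pi 1 = 0 := by
  ext e
  simp [sinFun]

lemma isFundamental_pi : IsFundamental ((Real.pi : ℂ) ^ 2) (cosFun G Real.pi) (sinFun G Real.pi) :=
  isFundamental_cos_sin (by simp [Real.pi_ne_zero])

variable [DecidableEq V] [Fintype V] [Fintype G.edgeSet]

/-- The kernel of the Laplacian with the CK-condition consists of the constants. -/
lemma rank_eigenspaceCK_zero [Nonempty G.edgeSet] (P : EdgeParam G) (hG : G.Connected) :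
    Module.rank ℂ (UnboundedOp.eigenspace (-laplacianCK P) 0) = 1 := by
  have : UnboundedOp.eigenspace (-laplacianCK P) 0 = Submodule.span ℂ {(1 : NetFun G)} := by
    ext u
    rw [mem_eigenspaceCK, Submodule.mem_span_singleton]
    constructor
    · rintro ⟨u', hu, hu', ht, hst⟩
      obtain ⟨e1, e2⟩ := eq_affine hu hu'
      obtain ⟨f, hf⟩ := (mem_constantEnds P _).1 ht
      have h0 : ∀ e, u 0 e = f (P.tail e) := fun e => hf (e, false)
      have h1 : ∀ e, u 1 e = f (P.head e) := fun e => hf (e, true)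
      have ha : ∀ e, u' 0 e = f (P.head e) - f (P.tail e) := fun e => by
        rw [← h0, ← h1]
        conv_rhs => rw [e1]
        simp [idFun]
      -- Pairing the flows with the conjugate vertex values gives the Dirichlet energy, a sum of
      -- squared moduli of the slopes, which must therefore all vanish.
      have hsum := sum_mul_eq_zero_of_mem_balancedEnds hst (fun v => star (f v))
      have hterm : ∀ e : G.edgeSet, star (f (P.head e)) * signedTrace G u' (e, true) +
          star (f (P.tail e)) * signedTrace G u' (e, false) = (Complex.normSq (u' 0 e) : ℝ) := by
        intro e
        rw [signedTrace_head, signedTrace_tail, e2]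
        simp only [ContinuousMap.const_apply]
        rw [← Complex.mul_conj, ha]
        simp
        ring
      simp only [hterm] at hsum
      rw [← Complex.ofReal_sum, Complex.ofReal_eq_zero,
        Finset.sum_eq_zero_iff_of_nonneg fun _ _ => Complex.normSq_nonneg _] at hsum
      have hz : u' 0 = 0 := funext fun e => Complex.normSq_eq_zero.1 (hsum e (Finset.mem_univ e))
      have hconst := hG.eq_of_forall_adj (f := f) (P.forall_adj (fun _ _ => Eq.symm) fun e => by
        have := ha e
        rw [hz] at this
        exact (sub_eq_zero.1 this.symm).symm)
      obtain ⟨v₀⟩ := hG.nonempty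
      refine ⟨f v₀, ?_⟩
      rw [e1, hz]
      ext x e
      simp [h0, hconst v₀ (P.tail e)]
    · rintro ⟨c, rfl⟩
      have hc : c • (1 : NetFun G) = ContinuousMap.const unitInterval (fun _ => c) := by
        ext x e
        simp
      rw [hc]
      refine ⟨0, isDeriv_const _, IsDeriv.const_of_eq_zero _, ?_, ?_⟩
      · exact (mem_constantEnds P _).2 ⟨fun _ => c, fun i => rfl⟩
      · rw [map_zero]
        exact zero_mem _
  rw [this, ← finrank_eq_rank, finrank_span_singleton one_ne_zero, Nat.cast_one]

/-- If the graph is not bipartite, then the eigenfunctions for the CK-condition and the eigenvalue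
`π²` vanish at the vertices. -/
lemma rank_eigenspaceCK_pi_le (P : EdgeParam G) (hG : G.Connected) (hb : ¬ G.IsBipartite) :
    Module.rank ℂ (UnboundedOp.eigenspace (-laplacianCK P) ((Real.pi : ℂ) ^ 2)) ≤
      Module.rank ℂ (LinearMap.ker (P.unsignedMatrix ℂ).mulVecLin) := by
  refine rank_le_of_isDeriv (ContinuousMap.evalCLM ℂ (0 : unitInterval)).toLinearMap fun u hu => ?_
  obtain ⟨u', hu, hu', ht, hst⟩ := (mem_eigenspaceCK P _ u).1 hu
  have e1 := isFundamental_pi.eq hu hu'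
  have e2 := isFundamental_pi.eq_deriv hu hu'
  obtain ⟨f, hf⟩ := (mem_constantEnds P _).1 ht
  have hu1 : ∀ e, u 1 e = -u 0 e := fun e => by
    conv_lhs => rw [e1]
    simp [cosFun_pi_one, sinFun_pi_one]
  have hu1' : ∀ e, u' 1 e = -u' 0 e := fun e => by
    conv_lhs => rw [e2]
    simp [cosFun_pi_one, sinFun_pi_one]
  -- A solution for `π²` is antiperiodic on `[0,1]`, so the vertex values alternate along edges.
  -- This is where the absence of a bipartition enters.
  have hf0 : f = 0 := hG.eq_zero_of_not_isBipartite hb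
    (P.forall_adj (fun v w h => by rw [h, neg_neg]) fun e => by
      rw [← vertex_tail, ← vertex_head, ← hf, ← hf, trace_head, trace_tail, hu1])
    fun x hx => self_eq_neg.1 hx
  have hu0 : u 0 = 0 := funext fun e => (hf (e, false)).trans (by rw [hf0]; rfl)
  refine ⟨u', hu, ?_, fun h => ?_⟩
  · refine (mem_ker_unsignedMatrix_iff P _).2 ?_
    have := Submodule.neg_mem _ hst
    convert this using 1
    funext i
    obtain ⟨e, _ | _⟩ := i
    · rw [Pi.neg_apply, signedTrace_tail, neg_neg]
      rfl
    · rw [Pi.neg_apply, signedTrace_head, hu1', neg_neg]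
      rfl
  · have h' : u' 0 = 0 := h
    rw [e1, hu0, h']
    ext x e
    simp

/-- A cosine of amplitude `β` has end values `β` and `-β`, balanced when `β` is in the cycle space,
and no derivative at the ends. The same sine on all edges vanishes at the ends and has equal outer
derivatives everywhere. The second kind is the extra factor `ℂ`. -/
lemma rank_le_rank_eigenspaceKC_pi [Nonempty G.edgeSet] (P : EdgeParam G) :
    Module.rank ℂ (LinearMap.ker (P.signedMatrix ℂ).mulVecLin × ℂ) ≤
      Module.rank ℂ (UnboundedOp.eigenspace (-laplacianKC P) ((Real.pi : ℂ) ^ 2)) := by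
  let L : LinearMap.ker (P.signedMatrix ℂ).mulVecLin × ℂ →ₗ[ℂ] NetFun G :=
    combination (cosFun G Real.pi) (sinFun G Real.pi) ∘ₗ
      (Submodule.subtype _).prodMap (LinearMap.pi fun _ => LinearMap.id)
  have hS := isFundamental_pi (G := G)
  have hd : ∀ p, IsDeriv (L p) (-((Real.pi : ℂ) ^ 2 • sinFun G Real.pi) *
      ContinuousMap.const unitInterval p.1.1 +
        cosFun G Real.pi * ContinuousMap.const unitInterval fun _ => p.2) := fun p =>
    (hS.derivC.mul_const _).add (hS.derivS.mul_const _)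
  have hL : ∀ p, L p ∈ UnboundedOp.eigenspace (-laplacianKC P) ((Real.pi : ℂ) ^ 2) := by
    intro p
    rw [mem_eigenspaceKC]
    refine ⟨_, hd p, ?_, ?_, ?_⟩
    · have := ((hS.derivS.smul ((Real.pi : ℂ) ^ 2)).neg.mul_const p.1.1).add
        (hS.derivC.mul_const fun _ => p.2)
      convert this using 1
      ext x e
      simp [L, combination]
      ring
    · have := Submodule.neg_mem _ ((mem_ker_signedMatrix_iff P _).1 p.1.2)
      convert this using 1
      funext i
      obtain ⟨e, _ | _⟩ := i
      · rw [trace_tail]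
        simp [L, combination, hS.C_zero, hS.S_zero, EdgeEnd.sign]
      · rw [trace_head]
        simp [L, combination, cosFun_pi_one, sinFun_pi_one, EdgeEnd.sign]
    · refine (mem_constantEnds P _).2 ⟨fun _ => -p.2, ?_⟩
      rintro ⟨e, _ | _⟩
      · rw [signedTrace_tail]
        simp [hS.C_zero, hS.S_zero]
      · rw [signedTrace_head]
        simp [cosFun_pi_one, sinFun_pi_one]
  refine (L.codRestrict _ hL).rank_le_of_injective ((injective_iff_map_eq_zero _).2 fun p hp => ?_)
  have h0 : L p = 0 := congrArg Subtype.val hp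
  have h1 := hd p
  rw [h0] at h1
  have h2 := DFunLike.congr_fun (h1.unique (isDeriv_const 0)) 0
  have h3 := DFunLike.congr_fun h0 0
  simp [L, combination, hS.C_zero, hS.S_zero] at h2 h3
  refine Prod.ext h3 ?_
  obtain ⟨e⟩ := ‹Nonempty G.edgeSet›
  exact congrFun h2 e

end QGraph

end

/-! ### Conclusion -/

open QGraph in
theorem corollary4p4 {V : Type*} [Fintype V] [DecidableEq V] [Nontrivial V]
    (G : SimpleGraph V) [DecidableRel G.Adj] (hG : G.Connected) (P : EdgeParam G) :
    UnboundedOp.SameSpectrum (-QGraph.laplacianCK P) (-QGraph.laplacianKC P) ↔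
      (IsUnicyclic G ∧ G.IsBipartite) := by
  have hne : Nonempty G.edgeSet := by
    obtain ⟨v⟩ := hG.nonempty
    obtain ⟨w, hw⟩ := hG.preconnected.exists_adj_of_nontrivial v
    exact ⟨⟨s(v, w), hw⟩⟩
  have hd := P.finrank_ker_signedMatrix ℂ hG
  rw [sameSpectrum_iff, isUnicyclic_iff P hG]
  have h0 : G.IsBipartite → (Module.rank ℂ (UnboundedOp.eigenspace (-laplacianCK P) 0) =
      Module.rank ℂ (UnboundedOp.eigenspace (-laplacianKC P) 0) ↔
        Fintype.card G.edgeSet = Fintype.card V) := by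
    intro hb
    obtain ⟨σ, h1, hσ⟩ := hb.exists_sign
    rw [rank_eigenspaceCK_zero P hG, rank_eigenspaceKC_zero P h1 hσ hG, ← Module.finrank_eq_rank,
      ← Nat.cast_one, Nat.cast_inj]
    omega
  constructor
  · intro h
    have hb : G.IsBipartite := by
      by_contra hb
      -- At `π²` equality of multiplicities would give `(#E - #V + 1) + 1 ≤ #E - #V`.
      have hle := (rank_le_rank_eigenspaceKC_pi P).trans
        ((h _).symm.le.trans (rank_eigenspaceCK_pi_le P hG hb))
      rw [← Module.finrank_eq_rank, ← Module.finrank_eq_rank, Nat.cast_le, Module.finrank_prod,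
        Module.finrank_self] at hle
      have := P.finrank_ker_unsignedMatrix ℂ hG hb two_ne_zero
      omega
    exact ⟨(h0 hb).1 (h 0), hb⟩
  · rintro ⟨hcard, hb⟩ z
    rcases eq_or_ne z 0 with rfl | hz
    · exact (h0 hb).2 hcard
    · obtain ⟨σ, h1, hσ⟩ := hb.exists_sign
      exact rank_eigenspace_eq_of_ne_zero P h1 hσ hz
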